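/- Let $N$ be a non-negative integer and let $\alpha,\beta\in\mathbb{C}$ satisfy $$-\alpha,\,-\beta\notin\{1,2,\dots,N,N+2,N+3,\dots\},\qquad -\alpha-\beta\notin\{1,2,\dots,2N+1,2N+3,2N+4,\dots\}.$$ With $(a)_0=1$, $(a)_n=a(a+1)\cdots(a+n-1)$, define for every $n\ge 0$ the monic Hahn polynomial $$h_n^{\alpha,\beta}(x;N)=\frac{(\alpha+1)_n}{(\alpha+\beta+n+1)_n}\sum_{k=0}^n\frac{(-n)_k(\alpha+\beta+n+1)_k(-x)_k(-N+k)_{n-k}}{(\alpha+1)_k\,k!},$$ where the quotients $(\alpha+1)_n/(\alpha+1)_k=(\alpha+1+k)_{n-k}$ and $(\alpha+\beta+n+1)_n/(\alpha+\beta+n+1)_k=(\alpha+\beta+n+1+k)_{n-k}$ are understood as cancelled, and terms with $(-N+k)_{n-k}=0$ are zero. For $x\in\{0,\dots,N\}$ and $z\in\mathbb{C}$ put $$\rho^{\alpha,\beta}(x;N)=\frac{\Gamma(\beta+N+1-x)\,\Gamma(\alpha+x+1)}{\Gamma(N+1-x)\,\Gamma(x+1)},\qquad \omega^{\alpha,\beta}(z;N)=\Gamma(-z)\Gamma(\beta+N+1-z)\Gamma(1+z)\Gamma(\alpha+N+2+z),$$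 where, if $\alpha=-N-1$ (so that $\Gamma(\alpha+x+1)$ is infinite at every $x\in\{0,\dots,N\}$), the factor $\Gamma(\alpha+x+1)$ is replaced by $(\alpha+1)_x=\lim_{a\to\alpha}\Gamma(a+x+1)/\Gamma(a+1)$, and, if $\beta=-N-1$, the factor $\Gamma(\beta+N+1-x)$ is replaced by $(\beta+1)_{N-x}$. There are piecewise $C^1$ contours $C$ from $-i\infty$ to $+i\infty$ (staying at bounded distance from the parametrized imaginary axis $t\mapsto it$, with bounded velocity) which separate the poles $k$, $\beta+N+1+k$ of $\Gamma(-z)\Gamma(\beta+N+1-z)$ (to the right of $C$) from the poles $-1-k$, $-\alpha-N-2-k$ of $\Gamma(1+z)\Gamma(\alpha+N+2+z)$ (to the left of $C$), $k=0,1,2,\dots$. Here a point $p\notin C$ is to the left (right) of $C$ if the principal value of $\frac1{2\pi i}\int_C\frac{dz}{z-p}$ is $\frac12$ (respectively $-\frac12$). For every such contour $C$, with $\Delta f(z)=f(z+1)-f(z)$, the integral in the $\Delta$-Sobolev inner product (a complex bilinear form, without conjugation) $$(f,g)_S=\sum_{x=0}^{N}f(x)g(x)\rho^{\alpha,\beta}(x;N)+\int_{C}(\Delta^{N+1}f)(z)\,(\Delta^{N+1}g)(z)\,\omega^{\alpha,\beta}(z;N)\,dz$$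 converges absolutely for all polynomials $f,g\in\mathbb{C}[x]$, and $(h_n^{\alpha,\beta}(x;N))_{n\ge0}$ is a monic orthogonal polynomial sequence (MOPS) with respect to $(\cdot,\cdot)_S$: each $h_n^{\alpha,\beta}$ is monic of degree $n$, $(h_n^{\alpha,\beta},h_m^{\alpha,\beta})_S=0$ for $n\ne m$, and $(h_n^{\alpha,\beta},h_n^{\alpha,\beta})_S\neq0$ for all $n$. Furthermore this inner product characterizes the family for all $n\ge0$: a polynomial $q$ equals $h_n^{\alpha,\beta}(x;N)$ if and only if $q$ is monic of degree $n$ and $(q,x^m)_S=0$ for all $0\le m<n$; in particular $(h_n^{\alpha,\beta})_{n\ge0}$ is the only MOPS with respect to $(\cdot,\cdot)_S$. -/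

import Mathlib

open Polynomial Filter Topology MeasureTheory

noncomputable section

/-- The Pochhammer symbol `(a)_n = a (a+1) ⋯ (a+n-1)`. -/
def poch (a : ℂ) (n : ℕ) : ℂ := (ascPochhammer ℂ n).eval a

/-- The monic Hahn polynomial `h_n^{α,β}(x;N)`, for every degree `n`:
`∑_{k=0}^{n} (-n)_k (-x)_k (-N+k)_{n-k} (α+1+k)_{n-k} / ((α+β+n+1+k)_{n-k} k!)`.
This is
`(α+1)_n / (α+β+n+1)_n · ∑_k (-n)_k (α+β+n+1)_k (-x)_k (-N+k)_{n-k} / ((α+1)_k k!)`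
after cancelling `(α+1)_n / (α+1)_k = (α+1+k)_{n-k}` and
`(α+β+n+1)_n / (α+β+n+1)_k = (α+β+n+1+k)_{n-k}`, so that removable zeros of denominators
have disappeared (a remaining `(α+β+n+1+k)_{n-k}` can vanish, for the parameters considered,
only in terms with `(-N+k)_{n-k} = 0`). -/
def hahnPoly (α β : ℂ) (N n : ℕ) : ℂ[X] :=
  ∑ k ∈ Finset.range (n + 1),
    C (poch (-(n : ℂ)) k * poch (-(N : ℂ) + k) (n - k) * poch (α + 1 + k) (n - k) /
        (poch (α + β + n + 1 + k) (n - k) * (k.factorial : ℂ))) *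
      (ascPochhammer ℂ k).comp (-X)

/-- `Γ(a + x + 1)`, the parameter-dependent factor of the discrete weight. For the one value
`a = -(N+1)` at which this is infinite at every mass point `x = 0, …, N`, it is normalised as
`(a+1)_x = lim_{a' → a} Γ(a' + x + 1) / Γ(a' + 1)`. -/
def weightGamma (N : ℕ) (a : ℂ) (x : ℕ) : ℂ :=
  if a = -((N : ℂ) + 1) then poch (a + 1) x else Complex.Gamma (a + x + 1)

/-- The discrete weight
`ρ^{α,β}(x;N) = Γ(β+N+1-x) Γ(α+x+1) / (Γ(N+1-x) Γ(x+1))` at a mass point `x = 0, …, N`. -/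
def hahnRho (α β : ℂ) (N x : ℕ) : ℂ :=
  weightGamma N β (N - x) * weightGamma N α x /
    (Complex.Gamma ((N : ℂ) + 1 - x) * Complex.Gamma ((x : ℂ) + 1))

/-- The continuous weight `ω^{α,β}(z;N) = Γ(-z) Γ(β+N+1-z) Γ(1+z) Γ(α+N+2+z)`. -/
def hahnOmega (α β : ℂ) (N : ℕ) (z : ℂ) : ℂ :=
  Complex.Gamma (-z) * Complex.Gamma (β + N + 1 - z) *
    Complex.Gamma (1 + z) * Complex.Gamma (α + N + 2 + z)

/-- A piecewise `C¹` contour in `ℂ` from `-i∞` to `+i∞`: it stays at bounded distance from the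
parametrised imaginary axis `t ↦ i t` and has bounded velocity. -/
structure IsVerticalContour (γ : ℝ → ℂ) : Prop where
  continuous : Continuous γ
  piecewise_C1 : ∃ S : Set ℝ, S.Finite ∧
    ∀ t ∉ S, DifferentiableAt ℝ γ t ∧ ContinuousAt (deriv γ) t
  velocity_bounded : ∃ M : ℝ, ∀ t, ‖deriv γ t‖ ≤ M
  vertical : ∃ M : ℝ, ∀ t, ‖γ t - t * Complex.I‖ ≤ M

/-- The point `p` is off `γ` and lies to the left of `γ`: the principal value of
`(2πi)⁻¹ ∫_γ dz / (z - p)` is `1/2`. (For a point to the left of an upward vertical line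
the value is `1/2`, for a point to the right it is `-1/2`; crossing the contour changes the
value by one. For a simple contour the values `1/2` and `-1/2` are taken on the two components
of the complement.) -/
def IsLeftOf (γ : ℝ → ℂ) (p : ℂ) : Prop :=
  (∀ t, γ t ≠ p) ∧
    Tendsto (fun T : ℝ => (2 * Real.pi * Complex.I)⁻¹ * ∫ t in (-T)..T, deriv γ t / (γ t - p))
      atTop (𝓝 (1 / 2))

/-- The point `p` is off `γ` and lies to the right of `γ`. -/
def IsRightOf (γ : ℝ → ℂ) (p : ℂ) : Prop :=
  (∀ t, γ t ≠ p) ∧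
    Tendsto (fun T : ℝ => (2 * Real.pi * Complex.I)⁻¹ * ∫ t in (-T)..T, deriv γ t / (γ t - p))
      atTop (𝓝 (-1 / 2))

/-- `γ` is a contour from `-i∞` to `+i∞` that separates the poles `k`, `β+N+1+k` of
`Γ(-z) Γ(β+N+1-z)` (on its right) from the poles `-1-k`, `-α-N-2-k` of
`Γ(1+z) Γ(α+N+2+z)` (on its left). -/
structure IsSeparatingContour (α β : ℂ) (N : ℕ) (γ : ℝ → ℂ) : Prop
    extends IsVerticalContour γ where
  right₁ : ∀ k : ℕ, IsRightOf γ k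
  right₂ : ∀ k : ℕ, IsRightOf γ (β + N + 1 + k)
  left₁ : ∀ k : ℕ, IsLeftOf γ (-1 - k)
  left₂ : ∀ k : ℕ, IsLeftOf γ (-α - N - 2 - k)

/-- The iterated forward difference `Δ^m f`, where `Δ f (z) = f (z+1) - f z`. -/
def deltaIter (m : ℕ) (f : ℂ[X]) : ℂ → ℂ := (fwdDiff (1 : ℂ))^[m] (fun z => f.eval z)

/-- The integrand of `∫_γ (Δ^{N+1} f)(z) (Δ^{N+1} g)(z) ω^{α,β}(z;N) dz` pulled back to `ℝ`. -/
def sobolevIntegrand (α β : ℂ) (N : ℕ) (γ : ℝ → ℂ) (f g : ℂ[X]) (t : ℝ) : ℂ :=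
  deltaIter (N + 1) f (γ t) * deltaIter (N + 1) g (γ t) * hahnOmega α β N (γ t) * deriv γ t

/-- The `Δ`-Sobolev inner product (a complex bilinear form, without conjugation)
`(f,g)_S = ∑_{x=0}^N f(x) g(x) ρ^{α,β}(x;N) + ∫_γ (Δ^{N+1} f)(Δ^{N+1} g) ω^{α,β}(z;N) dz`. -/
def sobolevForm (α β : ℂ) (N : ℕ) (γ : ℝ → ℂ) (f g : ℂ[X]) : ℂ :=
  ∑ x ∈ Finset.range (N + 1), f.eval (x : ℂ) * g.eval (x : ℂ) * hahnRho α β N x +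
    ∫ t : ℝ, sobolevIntegrand α β N γ f g t

/-- `p` is a monic orthogonal polynomial sequence for the form `B`. -/
structure IsMOPS (B : ℂ[X] → ℂ[X] → ℂ) (p : ℕ → ℂ[X]) : Prop where
  monic : ∀ n, (p n).Monic
  natDegree_eq : ∀ n, (p n).natDegree = n
  orthogonal : ∀ m n, m ≠ n → B (p m) (p n) = 0
  norm_ne_zero : ∀ n, B (p n) (p n) ≠ 0

end

noncomputable section

/-! ### Hahn polynomials and functionals satisfying a Pearson equation -/

/-! The two halves of the form act on disjoint ranges of degrees. For `n ≤ N` the operator `Δ^{N+1}`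
kills `h_n`, so only the sum matters. For `n > N` the polynomial `h_n` vanishes at `0, …, N`
(`eval_hahnPoly_eq_zero`), so only the integral matters, and `Δ^{N+1} h_n` is a nonzero multiple of
a Hahn-type polynomial of degree `n - N - 1` with shifted parameters (`iterate_polyDiff_hahnGen`).
What remains is ordinary orthogonality for two functionals, and both cases follow from one statement
about functionals with a Pearson equation (`IsPearson`).

The polynomials `hahnGen` are eigenfunctions of a second order difference operator
(`hahnOperator_hahnGen`). The Pearson equation is exactly what allows summation by parts for that
operator: it puts a `Δ` on each factor and replaces `L` by `p ↦ L ((x+a)(x+b) p)`, which again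
satisfies a Pearson equation. Induction on the degree gives orthogonality (`IsPearson.orthogonal`)
and reduces a nonzero norm to a nonzero total mass of the `n`-fold shifted functional
(`IsPearson.norm_ne_zero`). These masses obey a two-term recurrence
(`IsPearson.map_pearsonWeight_succ`).

For the sum, the Pearson equation telescopes. The mass recurrence is used downwards from `n = N`,
where only the point `x = 0` contributes. For the integral, the Pearson equation says that a
suitable meromorphic `F` has equal integrals over the contour and over its translate by one. The
contour may cross itself and its sides are known only through principal values, so the proof splits
`F` into polar parts and a holomorphic rest on a strip: the rest and the higher poles have
primitives, and simple poles are governed by the principal values (`tendsto_shift_of_sameSide`). One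
telescoping function with a single pole that changes side evaluates the initial mass
(`contourFunctional_one_ne_zero`), and the recurrence then runs upwards.

A separating contour is obtained from a vertical line: only finitely many poles are on its wrong
side, and each is moved across by inserting two circles of opposite orientation that enclose the
same poles except that one (`exists_toggle`). -/

/-- The polynomial `(-x)_k`. -/
def negPoch (k : ℕ) : ℂ[X] := (ascPochhammer ℂ k).comp (-X)

/-- The forward difference of a polynomial. -/
def polyDiff : ℂ[X] →ₗ[ℂ] ℂ[X] := taylor 1 - LinearMap.id

theorem polyDiff_apply (p : ℂ[X]) : polyDiff p = taylor 1 p - p := rfl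

theorem poch_zero (a : ℂ) : poch a 0 = 1 := by simp [poch]

theorem poch_succ (a : ℂ) (n : ℕ) : poch a (n + 1) = poch a n * (a + n) := by
  simp [poch, ascPochhammer_succ_eval]

theorem poch_succ_left (a : ℂ) (n : ℕ) : poch a (n + 1) = a * poch (a + 1) n := by
  simp [poch, ascPochhammer_succ_left]

theorem poch_eq_zero_iff (a : ℂ) (n : ℕ) : poch a n = 0 ↔ ∃ k < n, a = -(k : ℂ) := by
  rw [poch, ascPochhammer_eval_eq_zero_iff]
  exact exists_congr fun k => and_congr_right fun _ => by
    constructor <;> intro h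
    · rw [h, neg_neg]
    · rw [h, neg_neg]

theorem poch_neg_self (n : ℕ) : poch (-(n : ℂ)) n = (-1) ^ n * n.factorial := by
  induction n with
  | zero => simp [poch_zero]
  | succ n ih =>
    rw [poch_succ_left, show -((n + 1 : ℕ) : ℂ) + 1 = -(n : ℂ) by push_cast; ring, ih,
      Nat.factorial_succ]
    push_cast
    ring

theorem negPoch_zero : negPoch 0 = 1 := by simp [negPoch]

theorem negPoch_succ (k : ℕ) : negPoch (k + 1) = negPoch k * (-X + C (k : ℂ)) := by
  simp [negPoch, ascPochhammer_succ_right]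

theorem X_mul_negPoch (k : ℕ) : X * negPoch k = C (k : ℂ) * negPoch k - negPoch (k + 1) := by
  rw [negPoch_succ]; ring

theorem taylor_one_negPoch_succ (k : ℕ) :
    taylor 1 (negPoch (k + 1)) = (-X - 1) * negPoch k := by
  induction k with
  | zero => rw [negPoch_succ]; simp [negPoch_zero]; ring
  | succ k ih =>
    rw [negPoch_succ, taylor_mul, ih, negPoch_succ k]
    simp only [map_add, map_neg, taylor_X, taylor_C, Nat.cast_add, Nat.cast_one, C_1, taylor_one]
    ring

theorem polyDiff_negPoch_succ (k : ℕ) :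
    polyDiff (negPoch (k + 1)) = -C ((k : ℂ) + 1) * negPoch k := by
  rw [polyDiff_apply, taylor_one_negPoch_succ, negPoch_succ, map_add, C_1]; ring

theorem polyDiff_negPoch_zero : polyDiff (negPoch 0) = 0 := by
  simp [polyDiff_apply, negPoch_zero]

theorem X_mul_taylor_neg_one_negPoch (k : ℕ) :
    X * taylor (-1) (negPoch k) = -negPoch (k + 1) := by
  induction k with
  | zero => simp [negPoch_succ, negPoch_zero]
  | succ k ih =>
    rw [negPoch_succ k, taylor_mul, ← mul_assoc, ih, negPoch_succ (k + 1)]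
    simp only [map_add, map_neg, taylor_X, taylor_C, Nat.cast_add, Nat.cast_one, C_1]
    ring

theorem monic_negPoch_smul (k : ℕ) : (C ((-1 : ℂ) ^ k) * negPoch k).Monic ∧
    (C ((-1 : ℂ) ^ k) * negPoch k).natDegree = k := by
  induction k with
  | zero => simp [negPoch_zero]
  | succ k ih =>
    have h : C ((-1 : ℂ) ^ (k + 1)) * negPoch (k + 1) =
        C ((-1 : ℂ) ^ k) * negPoch k * (X - C (k : ℂ)) := by
      rw [negPoch_succ, pow_succ, map_mul, map_neg, map_one]; ring
    rw [h]
    refine ⟨ih.1.mul (monic_X_sub_C _), ?_⟩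
    rw [ih.1.natDegree_mul (monic_X_sub_C _), ih.2, natDegree_X_sub_C]

theorem natDegree_negPoch_le (k : ℕ) : (negPoch k).natDegree ≤ k := by
  have h : negPoch k = C ((-1 : ℂ) ^ k) * (C ((-1 : ℂ) ^ k) * negPoch k) := by
    rw [← mul_assoc, ← C_mul, ← mul_pow]; simp
  rw [h]
  exact (natDegree_C_mul_le _ _).trans (monic_negPoch_smul k).2.le

theorem eval_negPoch_eq_zero {k x : ℕ} (h : x < k) : (negPoch k).eval (x : ℂ) = 0 := by
  have : poch (-(x : ℂ)) k = 0 := (poch_eq_zero_iff _ _).2 ⟨x, h, rfl⟩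
  simpa [negPoch, poch] using this

/-- The coefficient of `(-x)_k` in the monic Hahn polynomial of degree `n` with parameters
`a`, `b`, `σ`. -/
def hahnCoeff (a b σ : ℂ) (n k : ℕ) : ℂ :=
  poch (-(n : ℂ)) k * poch (b + k) (n - k) * poch (a + k) (n - k) /
    (poch (σ + n - 1 + k) (n - k) * (k.factorial : ℂ))

/-- Monic Hahn-type polynomials
`∑_k (-n)_k (b+k)_{n-k} (a+k)_{n-k} / ((σ+n-1+k)_{n-k} k!) (-x)_k`. -/
def hahnGen (a b σ : ℂ) (n : ℕ) : ℂ[X] :=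
  ∑ k ∈ Finset.range (n + 1), C (hahnCoeff a b σ n k) * negPoch k

theorem hahnPoly_eq_hahnGen (α β : ℂ) (N n : ℕ) :
    hahnPoly α β N n = hahnGen (α + 1) (-(N : ℂ)) (α + β + 2) n := by
  refine Finset.sum_congr rfl fun k _ => ?_
  rw [hahnCoeff, show α + β + 2 + (n : ℂ) - 1 + k = α + β + n + 1 + k by ring, negPoch]

theorem hahnCoeff_self (a b σ : ℂ) (n : ℕ) : hahnCoeff a b σ n n = (-1) ^ n := by
  have : (n.factorial : ℂ) ≠ 0 := by exact_mod_cast n.factorial_ne_zero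
  simp [hahnCoeff, poch_zero, poch_neg_self, this]

theorem hahnGen_monic (a b σ : ℂ) (n : ℕ) :
    (hahnGen a b σ n).Monic ∧ (hahnGen a b σ n).natDegree = n := by
  have hm := monic_negPoch_smul n
  rw [hahnGen, Finset.sum_range_succ, hahnCoeff_self]
  set q := ∑ k ∈ Finset.range n, C (hahnCoeff a b σ n k) * negPoch k with hq
  have hlt : q.degree < (C ((-1 : ℂ) ^ n) * negPoch n).degree := by
    rw [degree_eq_natDegree hm.1.ne_zero, hm.2, hq]
    refine (degree_sum_le _ _).trans_lt ((Finset.sup_lt_iff (WithBot.bot_lt_coe n)).2 fun k hk => ?_)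
    refine degree_le_natDegree.trans_lt ?_
    exact Nat.cast_lt.2 (((natDegree_C_mul_le _ _).trans (natDegree_negPoch_le k)).trans_lt
      (Finset.mem_range.1 hk))
  refine ⟨hm.1.add_of_right hlt, ?_⟩
  rw [natDegree_add_eq_right_of_degree_lt hlt, hm.2]

/-- The numerators and denominators match after the shift `(a, b, σ) ↦ (a+1, b+1, σ+2)`; this makes
`Δ` lower the degree within the family. -/
theorem hahnCoeff_succ_succ (a b σ : ℂ) (n k : ℕ) :
    -(hahnCoeff a b σ (n + 1) (k + 1) * (k + 1)) =
      (n + 1) * hahnCoeff (a + 1) (b + 1) (σ + 2) n k := by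
  have h1 : (k : ℂ) + 1 ≠ 0 := by exact_mod_cast k.succ_ne_zero
  have h2 : (k.factorial : ℂ) ≠ 0 := by exact_mod_cast k.factorial_ne_zero
  rw [hahnCoeff, hahnCoeff, poch_succ_left, Nat.add_sub_add_right, Nat.factorial_succ]
  push_cast
  rw [show -((n : ℂ) + 1) + 1 = -n by ring, show b + ((k : ℂ) + 1) = b + 1 + k by ring,
    show a + ((k : ℂ) + 1) = a + 1 + k by ring,
    show σ + ((n : ℂ) + 1) - 1 + (k + 1) = σ + 2 + n - 1 + k by ring]
  -- When the denominator vanishes, both coefficients are `0` by the convention `x / 0 = 0`, so no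
  -- condition on `σ` is needed.
  by_cases h3 : poch (σ + 2 + n - 1 + k) (n - k) = 0
  · simp [h3]
  · field_simp

theorem polyDiff_C_mul (c : ℂ) (p : ℂ[X]) : polyDiff (C c * p) = C c * polyDiff p := by
  rw [← smul_eq_C_mul, map_smul, smul_eq_C_mul]

theorem polyDiff_hahnGen_succ (a b σ : ℂ) (n : ℕ) :
    polyDiff (hahnGen a b σ (n + 1)) = C ((n : ℂ) + 1) * hahnGen (a + 1) (b + 1) (σ + 2) n := by
  rw [hahnGen, map_sum, Finset.sum_range_succ', polyDiff_C_mul, polyDiff_negPoch_zero, mul_zero,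
    add_zero, hahnGen, Finset.mul_sum]
  refine Finset.sum_congr rfl fun k _ => ?_
  rw [polyDiff_C_mul, polyDiff_negPoch_succ, ← mul_assoc, ← mul_assoc, ← C_mul,
    ← hahnCoeff_succ_succ]
  simp only [map_mul, map_neg]
  ring

theorem iterate_polyDiff_hahnGen (m : ℕ) : ∀ (a b σ : ℂ) (n : ℕ),
    ∃ c : ℂ, c ≠ 0 ∧ (polyDiff^[m]) (hahnGen a b σ (n + m)) =
      C c * hahnGen (a + m) (b + m) (σ + 2 * m) n := by
  induction m with
  | zero => intro a b σ n; exact ⟨1, one_ne_zero, by simp⟩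
  | succ m ih =>
    intro a b σ n
    obtain ⟨c, hc, h⟩ := ih (a + 1) (b + 1) (σ + 2) n
    refine ⟨((n + m : ℕ) + 1 : ℂ) * c,
      mul_ne_zero (by exact_mod_cast (n + m).succ_ne_zero) hc, ?_⟩
    have hsmul : ∀ (m : ℕ) (c : ℂ) (p : ℂ[X]), (polyDiff^[m]) (C c * p) = C c * (polyDiff^[m]) p := by
      intro m
      induction m with
      | zero => simp
      | succ m ih => intro c p; rw [Function.iterate_succ_apply, polyDiff_C_mul, ih,
          ← Function.iterate_succ_apply]
    rw [Function.iterate_succ_apply, ← add_assoc, polyDiff_hahnGen_succ, hsmul, h, C_mul, mul_assoc]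
    push_cast
    rw [show a + 1 + (m : ℂ) = a + (m + 1) by ring, show b + 1 + (m : ℂ) = b + (m + 1) by ring,
      show σ + 2 + 2 * (m : ℂ) = σ + 2 * (m + 1) by ring]

theorem natDegree_polyDiff_lt {p : ℂ[X]} (n : ℕ) (h : p.degree < (n + 1 : ℕ)) :
    (polyDiff p).degree < n := by
  by_cases h0 : p.natDegree = 0
  · rw [eq_C_of_natDegree_eq_zero h0, polyDiff_apply, taylor_C, sub_self, degree_zero]
    exact WithBot.bot_lt_coe n
  have hp : p ≠ 0 := fun h => h0 (by simp [h])
  have hd : (polyDiff p).degree < p.degree := by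
    rw [polyDiff_apply, ← degree_taylor p 1]
    refine degree_sub_lt_left (degree_taylor p 1) ?_ ?_
    · rwa [Ne, taylor_eq_zero]
    · exact leadingCoeff_taylor (r := (1 : ℂ)) (f := p)
  refine hd.trans_le ?_
  rw [degree_eq_natDegree hp] at h ⊢
  exact_mod_cast Nat.lt_succ_iff.1 (by exact_mod_cast h)

theorem iterate_polyDiff_eq_zero {p : ℂ[X]} (n : ℕ) (h : p.degree < n) :
    (polyDiff^[n]) p = 0 := by
  induction n generalizing p with
  | zero => simpa using h
  | succ n ih => exact ih (natDegree_polyDiff_lt n h)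

/-! ### Functionals with a Pearson equation: orthogonality and norms -/

/-- The linear functional `L` satisfies the Pearson equation
`L (p(x+1) (x+a) (x+b) - p(x) x (x-d)) = 0`. -/
def IsPearson (L : ℂ[X] →ₗ[ℂ] ℂ) (a b d : ℂ) : Prop :=
  ∀ p : ℂ[X], L (taylor 1 p * ((X + C a) * (X + C b)) - p * (X * (X - C d))) = 0

/-- The functional `p ↦ L ((x+a)(x+b) p)`. -/
def shiftFunctional (L : ℂ[X] →ₗ[ℂ] ℂ) (a b : ℂ) : ℂ[X] →ₗ[ℂ] ℂ :=
  L ∘ₗ LinearMap.mulLeft ℂ ((X + C a) * (X + C b))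

theorem shiftFunctional_apply (L : ℂ[X] →ₗ[ℂ] ℂ) (a b : ℂ) (p : ℂ[X]) :
    shiftFunctional L a b p = L ((X + C a) * (X + C b) * p) := rfl

theorem map_C_mul (L : ℂ[X] →ₗ[ℂ] ℂ) (c : ℂ) (p : ℂ[X]) : L (C c * p) = c * L p := by
  rw [← smul_eq_C_mul, map_smul, smul_eq_mul]

/-- Insert `p (x+a)(x+b)` for `p` in the equation of `L`. Since `d` is unchanged, `σ = a + b + d`
grows by `2`, as it does for the polynomials under `Δ`. -/
theorem IsPearson.shift {L : ℂ[X] →ₗ[ℂ] ℂ} {a b d : ℂ} (h : IsPearson L a b d) :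
    IsPearson (shiftFunctional L a b) (a + 1) (b + 1) d := by
  intro p
  rw [shiftFunctional_apply, ← h (p * ((X + C a) * (X + C b)))]
  congr 1
  simp only [taylor_mul, map_add, taylor_X, taylor_C, map_one]
  ring

/-- The second order difference operator
`y ↦ (x+a)(x+b) (y(x+1) - y(x)) - x(x-d) (y(x) - y(x-1))`. -/
def hahnOperator (a b d : ℂ) (y : ℂ[X]) : ℂ[X] :=
  (X + C a) * (X + C b) * polyDiff y - X * (X - C d) * (y - taylor (-1) y)

/-- The Pearson equation for `p = (y(x) - y(x-1)) g(x)`, where `p(x+1) = Δy · (g + Δg)`. -/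
theorem IsPearson.summation_by_parts {L : ℂ[X] →ₗ[ℂ] ℂ} {a b d : ℂ} (h : IsPearson L a b d)
    (y g : ℂ[X]) :
    L (hahnOperator a b d y * g) = -shiftFunctional L a b (polyDiff y * polyDiff g) := by
  have h1 := h ((y - taylor (-1) y) * g)
  rw [taylor_mul, map_sub (taylor 1), taylor_taylor, add_neg_cancel, taylor_zero] at h1
  rw [shiftFunctional_apply, eq_neg_iff_add_eq_zero, ← map_add, ← h1, hahnOperator, polyDiff_apply,
    polyDiff_apply]
  congr 1
  ring

theorem hahnOperator_sum (a b d : ℂ) (n : ℕ) (c : ℕ → ℂ) (f : ℕ → ℂ[X]) :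
    hahnOperator a b d (∑ k ∈ Finset.range n, C (c k) * f k) =
      ∑ k ∈ Finset.range n, C (c k) * hahnOperator a b d (f k) := by
  simp only [hahnOperator, map_sum, polyDiff_C_mul, taylor_mul, taylor_C, Finset.mul_sum,
    ← Finset.sum_sub_distrib]
  exact Finset.sum_congr rfl fun k _ => by ring

theorem hahnOperator_negPoch_zero (a b d : ℂ) : hahnOperator a b d (negPoch 0) = 0 := by
  simp [hahnOperator, polyDiff_apply, negPoch_zero]

/-- The operator is bidiagonal in the basis `(-x)_k`, so the eigenvalue equation becomes a two-term
recurrence for the coefficients. -/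
theorem hahnOperator_negPoch_succ (a b d : ℂ) (k : ℕ) :
    hahnOperator a b d (negPoch (k + 1)) =
      C ((k + 1) * (k + a + b + d)) * negPoch (k + 1) -
        C ((k + 1) * (k + a) * (k + b)) * negPoch k := by
  have h1 : X * (negPoch (k + 1) - taylor (-1) (negPoch (k + 1))) =
      C ((k : ℂ) + 1) * negPoch (k + 1) := by
    rw [mul_sub, X_mul_taylor_neg_one_negPoch, X_mul_negPoch]; push_cast; ring
  rw [hahnOperator, polyDiff_negPoch_succ, mul_comm X, mul_assoc (X - C d), h1, negPoch_succ]
  simp only [map_mul, map_add, map_one]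
  ring

theorem hahnCoeff_recurrence (a b σ : ℂ) {n k : ℕ} (hk : k < n) (hσ : σ + n - 1 + k ≠ 0) :
    hahnCoeff a b σ n k * ((k : ℂ) * (k + σ - 1) - n * (n + σ - 1)) =
      hahnCoeff a b σ n (k + 1) * ((k + 1) * (k + a) * (k + b)) := by
  obtain ⟨m, rfl⟩ := Nat.exists_eq_add_of_lt hk
  have h1 : (k : ℂ) + 1 ≠ 0 := by exact_mod_cast k.succ_ne_zero
  have h2 : (k.factorial : ℂ) ≠ 0 := by exact_mod_cast k.factorial_ne_zero
  rw [hahnCoeff, hahnCoeff, show k + m + 1 - k = m + 1 by omega,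
    show k + m + 1 - (k + 1) = m by omega, poch_succ _ k, poch_succ_left (b + k),
    poch_succ_left (a + k), poch_succ_left (_ + (k : ℂ)), Nat.factorial_succ]
  push_cast at hσ ⊢
  rw [show b + ((k : ℂ) + 1) = b + k + 1 by ring, show a + ((k : ℂ) + 1) = a + k + 1 by ring,
    show σ + ((k : ℂ) + m + 1) - 1 + (k + 1) = σ + (k + m + 1) - 1 + k + 1 by ring]
  -- The two denominators share this factor; if it is zero both sides are `0` by convention. Only
  -- the extra factor, nonzero by `hσ`, has to be cancelled.
  by_cases h3 : poch (σ + ((k : ℂ) + m + 1) - 1 + k + 1) m = 0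
  · simp [h3]
  · field_simp
    ring

theorem hahnOperator_hahnGen {a b d σ : ℂ} (hs : σ = a + b + d) (n : ℕ)
    (hσ : ∀ k < n, σ + n - 1 + k ≠ 0) :
    hahnOperator a b d (hahnGen a b σ n) = C ((n : ℂ) * (n + σ - 1)) * hahnGen a b σ n := by
  have key : ∀ k, hahnOperator a b d (negPoch k) =
      C ((k : ℂ) * (k + σ - 1)) * negPoch k -
        C ((k : ℂ) * ((k : ℂ) - 1 + a) * ((k : ℂ) - 1 + b)) * negPoch (k - 1) := by
    intro k
    cases k with
    | zero => simp [hahnOperator_negPoch_zero]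
    | succ k =>
      rw [hahnOperator_negPoch_succ, hs, Nat.add_sub_cancel]
      push_cast
      congr 3 <;> ring_nf
  rw [hahnGen, hahnOperator_sum, Finset.mul_sum]
  simp only [key, mul_sub (C (hahnCoeff a b σ n _)), Finset.sum_sub_distrib]
  -- The diagonal contribution at `k = n` cancels against the eigenvalue, and the lowering
  -- contribution at `k = 0` has a factor `k`. The remaining sums are aligned by an index shift.
  rw [sub_eq_iff_eq_add', ← sub_eq_iff_eq_add, ← Finset.sum_sub_distrib, Finset.sum_range_succ,
    Finset.sum_range_succ']
  have h1 : C (hahnCoeff a b σ n n) * (C ((n : ℂ) * (n + σ - 1)) * negPoch n) -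
      C ((n : ℂ) * (n + σ - 1)) * (C (hahnCoeff a b σ n n) * negPoch n) = 0 := by ring
  rw [h1, add_zero]
  simp only [Nat.cast_zero, zero_mul, map_zero, mul_zero, add_zero, Nat.add_sub_cancel]
  refine Finset.sum_congr rfl fun k hk => ?_
  have h2 := hahnCoeff_recurrence a b σ (Finset.mem_range.1 hk) (hσ k (Finset.mem_range.1 hk))
  push_cast
  rw [show (k : ℂ) + 1 - 1 = k by ring, ← mul_assoc, ← mul_assoc, ← mul_assoc, ← C_mul, ← C_mul,
    ← C_mul, ← h2, ← sub_mul, ← C_sub]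
  congr 2
  ring

/-- The inductive step for both orthogonality and norms: summation by parts with the eigenvalue
`(n+1)(n+σ)`, after cancelling the factor `n+1` that `Δ` also produces. -/
theorem IsPearson.map_hahnGen_mul {L : ℂ[X] →ₗ[ℂ] ℂ} {a b d σ : ℂ} (h : IsPearson L a b d)
    (hs : σ = a + b + d) (n : ℕ) (hσ : ∀ k < n + 1, σ + (n + 1 : ℕ) - 1 + k ≠ 0) (g : ℂ[X]) :
    (n + σ) * L (hahnGen a b σ (n + 1) * g) =
      -shiftFunctional L a b (hahnGen (a + 1) (b + 1) (σ + 2) n * polyDiff g) := by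
  have h1 := h.summation_by_parts (hahnGen a b σ (n + 1)) g
  rw [hahnOperator_hahnGen hs _ hσ, polyDiff_hahnGen_succ, mul_assoc, map_C_mul, mul_assoc (C _),
    map_C_mul] at h1
  have h2 : (n : ℂ) + 1 ≠ 0 := by exact_mod_cast n.succ_ne_zero
  apply mul_left_cancel₀ h2
  push_cast at h1
  linear_combination h1

theorem IsPearson.orthogonal (n : ℕ) : ∀ {L : ℂ[X] →ₗ[ℂ] ℂ} {a b d σ : ℂ}, IsPearson L a b d →
    σ = a + b + d → (∀ k < n, σ + n - 1 + k ≠ 0) → ∀ g : ℂ[X], g.degree < n →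
      L (hahnGen a b σ n * g) = 0 := by
  induction n with
  | zero =>
    intro L a b d σ _ _ _ g hg
    have : g = 0 := by simpa using hg
    simp [this]
  | succ n ih =>
    intro L a b d σ h hs hσ g hg
    have h1 := h.map_hahnGen_mul hs n hσ g
    have h0 := hσ 0 n.succ_pos
    have h2 : (n : ℂ) + σ ≠ 0 := by
      intro h3; apply h0; push_cast; linear_combination h3
    have h4 := ih h.shift (σ := σ + 2) (by rw [hs]; ring) (fun k hk => ?_) _
      (natDegree_polyDiff_lt n hg)
    · rw [h4, neg_zero] at h1
      exact (mul_eq_zero.1 h1).resolve_left h2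
    · have := hσ (k + 1) (by omega)
      intro h3; apply this; push_cast; linear_combination h3

/-- The polynomial `∏_{j<n} (x+a+j)(x+b+j)`. -/
def pearsonWeight (a b : ℂ) (n : ℕ) : ℂ[X] :=
  ∏ j ∈ Finset.range n, (X + C (a + j)) * (X + C (b + j))

theorem pearsonWeight_succ (a b : ℂ) (n : ℕ) :
    pearsonWeight a b (n + 1) = (X + C a) * (X + C b) * pearsonWeight (a + 1) (b + 1) n := by
  rw [pearsonWeight, Finset.prod_range_succ', mul_comm, pearsonWeight]
  simp only [Nat.cast_zero, add_zero]
  congr 1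
  refine Finset.prod_congr rfl fun j _ => ?_
  push_cast
  rw [show a + ((j : ℂ) + 1) = a + 1 + j by ring, show b + ((j : ℂ) + 1) = b + 1 + j by ring]

/-- Passing to the shifted functional reduces everything to `n = 0`, where the Pearson equation for
`1` and `X` gives two relations among the moments of order at most two. -/
theorem IsPearson.map_pearsonWeight_succ (n : ℕ) : ∀ {L : ℂ[X] →ₗ[ℂ] ℂ} {a b d σ : ℂ},
    IsPearson L a b d → σ = a + b + d →
    (σ + 2 * n) * (σ + 2 * n + 1) * L (pearsonWeight a b (n + 1)) =
      (a + n) * (b + n) * (a + n + d) * (b + n + d) * L (pearsonWeight a b n) := by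
  induction n with
  | zero =>
    intro L a b d σ h hs
    have h1 := h 1
    have h2 := h X
    simp only [pearsonWeight, zero_add, Finset.prod_range_one, Finset.prod_range_zero, Nat.cast_zero,
      add_zero, mul_zero]
    have e1 : taylor 1 (1 : ℂ[X]) * ((X + C a) * (X + C b)) - 1 * (X * (X - C d)) =
        C σ * X + C (a * b) * 1 := by
      simp only [taylor_one, hs, map_add, map_mul, map_one]; ring
    have e2 : taylor 1 (X : ℂ[X]) * ((X + C a) * (X + C b)) - X * (X * (X - C d)) =
        C (σ + 1) * X ^ 2 + C (a * b + a + b) * X + C (a * b) * 1 := by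
      simp only [taylor_X, hs, map_add, map_mul, map_one]; ring
    have e3 : (X + C a) * (X + C b) = X ^ 2 + C (a + b) * X + C (a * b) * 1 := by
      simp only [map_add, map_mul]; ring
    rw [e1] at h1
    rw [e2] at h2
    rw [e3]
    simp only [map_add L, map_C_mul] at h1 h2 ⊢
    subst hs
    -- The multiple of `h2` removes the second moment, the multiple of `h1` then removes the first;
    -- only `L 1` is left.
    linear_combination (a + b + d) * h2 +
      ((a + b) * (a + b + d + 1) - (a * b + a + b)) * h1
  | succ n ih =>
    intro L a b d σ h hs
    have h1 := ih h.shift (σ := σ + 2) (by rw [hs]; ring)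
    rw [shiftFunctional_apply, shiftFunctional_apply, ← pearsonWeight_succ, ← pearsonWeight_succ]
      at h1
    push_cast
    linear_combination h1

/-- If the norm in degree `n+1` vanished, so would the norm in degree `n` for the shifted
functional. After `n` shifts this is the mass `L (pearsonWeight a b n)`. -/
theorem IsPearson.norm_ne_zero (n : ℕ) : ∀ {L : ℂ[X] →ₗ[ℂ] ℂ} {a b d σ : ℂ}, IsPearson L a b d →
    σ = a + b + d → (∀ k < n, σ + n - 1 + k ≠ 0) → L (pearsonWeight a b n) ≠ 0 →
      L (hahnGen a b σ n * hahnGen a b σ n) ≠ 0 := by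
  induction n with
  | zero =>
    intro L a b d σ _ _ _ hL
    have : hahnGen a b σ 0 = 1 := by
      simp [hahnGen, hahnCoeff_self, negPoch_zero]
    simpa [this, pearsonWeight] using hL
  | succ n ih =>
    intro L a b d σ h hs hσ hL h0
    have h1 := h.map_hahnGen_mul hs n hσ (hahnGen a b σ (n + 1))
    rw [h0, mul_zero, polyDiff_hahnGen_succ, mul_left_comm, map_C_mul, eq_comm,
      neg_eq_zero] at h1
    refine ih h.shift (σ := σ + 2) (by rw [hs]; ring) (fun k hk => ?_) ?_
      ((mul_eq_zero.1 h1).resolve_left (by exact_mod_cast n.succ_ne_zero))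
    · have := hσ (k + 1) (by omega)
      intro h3; apply this; push_cast; linear_combination h3
    · rwa [shiftFunctional_apply, ← pearsonWeight_succ]

/-! ### Shifting the contour of integration by one -/

/-- The open vertical strip `|Re z| < R`. -/
def vStrip (R : ℝ) : Set ℂ := {z | |z.re| < R}

/-- The filter of points of the strip `|Re z| < R` with `|Im z| → ∞`. -/
def vEnds (R : ℝ) : Filter ℂ := comap (fun z : ℂ => |z.im|) atTop ⊓ 𝓟 (vStrip R)

theorem isOpen_vStrip (R : ℝ) : IsOpen (vStrip R) :=
  isOpen_lt Complex.continuous_re.abs continuous_const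

theorem convex_vStrip (R : ℝ) : Convex ℝ (vStrip R) := by
  have : vStrip R = Complex.reLm ⁻¹' (Set.Ioo (-R) R) := by
    ext z; simp [vStrip, abs_lt]
  rw [this]
  exact (convex_Ioo _ _).linear_preimage _

theorem eventually_vEnds {R : ℝ} {P : ℂ → Prop} :
    (∀ᶠ z in vEnds R, P z) ↔ ∃ Y : ℝ, ∀ z ∈ vStrip R, Y ≤ |z.im| → P z := by
  rw [vEnds, eventually_inf_principal, eventually_comap, ]
  constructor
  · intro h
    obtain ⟨Y, hY⟩ := eventually_atTop.1 h
    exact ⟨Y, fun z hz hzY => hY _ hzY z rfl hz⟩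
  · rintro ⟨Y, hY⟩
    filter_upwards [eventually_ge_atTop Y] with y hy z hz hzs
    exact hY z hzs (hz ▸ hy)

theorem tendsto_norm_vEnds (R : ℝ) : Tendsto (fun z : ℂ => ‖z‖) (vEnds R) atTop :=
  tendsto_atTop_mono Complex.abs_im_le_norm (tendsto_comap.mono_left inf_le_left)

theorem tendsto_inv_sub_vEnds (R : ℝ) (p : ℂ) :
    Tendsto (fun z : ℂ => (z - p)⁻¹) (vEnds R) (𝓝 0) := by
  rw [tendsto_zero_iff_norm_tendsto_zero]
  simp only [norm_inv]
  refine tendsto_inv_atTop_zero.comp ?_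
  have h := tendsto_atTop_add_const_right (vEnds R) (-‖p‖) (tendsto_norm_vEnds R)
  exact tendsto_atTop_mono (fun z => by have := norm_sub_norm_le z p; linarith) h

theorem add_one_mem_vStrip {R : ℝ} {z : ℂ} (h : |z.re| + 1 < R) : z + 1 ∈ vStrip R := by
  have := abs_add_le z.re 1
  simp only [vStrip, Set.mem_ofPred, Complex.add_re, Complex.one_re]
  rw [abs_one] at this
  linarith

theorem mem_vStrip_of_add_one {R : ℝ} {z : ℂ} (h : |z.re| + 1 < R) : z ∈ vStrip R := by
  simp only [vStrip, Set.mem_ofPred]; linarith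

namespace IsVerticalContour

variable {γ : ℝ → ℂ}

theorem intervalIntegrable_mul_deriv (hγ : IsVerticalContour γ)
    {g : ℝ → ℂ} (hg : Continuous g) (a b : ℝ) :
    IntervalIntegrable (fun t => g t * deriv γ t) volume a b := by
  obtain ⟨M, hM⟩ := hγ.velocity_bounded
  have h : IntervalIntegrable (deriv γ) volume a b := by
    refine (intervalIntegrable_const (c := M)).mono_fun
      (measurable_deriv γ).aestronglyMeasurable (Eventually.of_forall fun t => ?_)
    exact (hM t).trans (Real.le_norm_self M)
  exact h.continuousOn_mul hg.continuousOn

theorem exists_re_lt (hγ : IsVerticalContour γ) : ∃ R : ℝ, ∀ t, |(γ t).re| + 1 < R := by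
  obtain ⟨M, hM⟩ := hγ.vertical
  refine ⟨M + 2, fun t => ?_⟩
  have h := (Complex.abs_re_le_norm (γ t - t * Complex.I)).trans (hM t)
  simp only [Complex.sub_re, Complex.mul_re, Complex.ofReal_re, Complex.I_re, mul_zero,
    Complex.ofReal_im, Complex.I_im, mul_one, sub_self, sub_zero] at h
  linarith

theorem exists_im_sub_le (hγ : IsVerticalContour γ) : ∃ M : ℝ, ∀ t, |(γ t).im - t| ≤ M := by
  obtain ⟨M, hM⟩ := hγ.vertical
  refine ⟨M, fun t => ?_⟩
  simpa using (Complex.abs_im_le_norm (γ t - t * Complex.I)).trans (hM t)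

/-- The fundamental theorem of calculus along a vertical contour. -/
theorem integral_deriv_comp (hγ : IsVerticalContour γ)
    {F G : ℂ → ℂ} (hG : ∀ t, HasDerivAt G (F (γ t)) (γ t))
    (hF : Continuous fun t => F (γ t)) (a b : ℝ) :
    ∫ t in a..b, F (γ t) * deriv γ t = G (γ b) - G (γ a) := by
  obtain ⟨S, hS, hd⟩ := hγ.piecewise_C1
  refine integral_eq_of_hasDerivAt_off_countable (fun t => G (γ t)) _
    (s := S) hS.countable (fun t _ => ?_) (fun t ht => ?_)
    (hγ.intervalIntegrable_mul_deriv hF a b)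
  · exact ((hG t).continuousAt.comp hγ.continuous.continuousAt).continuousWithinAt
  · exact (hG t).comp t (hd t ht.2).1.hasDerivAt

/-- If `F` has a primitive `G` with `G (z + 1) - G z → 0` at the ends of the strip, then the
difference of the integrals of `F` over `γ + 1` and over `γ` vanishes. -/
theorem tendsto_shift_of_primitive (hγ : IsVerticalContour γ)
    {R : ℝ} (hR : ∀ t, |(γ t).re| + 1 < R) {F G : ℂ → ℂ}
    (h0 : ∀ t, HasDerivAt G (F (γ t)) (γ t)) (h1 : ∀ t, HasDerivAt G (F (γ t + 1)) (γ t + 1))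
    (c0 : Continuous fun t => F (γ t)) (c1 : Continuous fun t => F (γ t + 1))
    (hG : ∀ ε > 0, ∃ Y : ℝ, ∀ z : ℂ, |z.re| + 1 < R → Y ≤ |z.im| → ‖G (z + 1) - G z‖ ≤ ε) :
    Tendsto (fun T : ℝ => ∫ t in (-T)..T, (F (γ t + 1) - F (γ t)) * deriv γ t) atTop (𝓝 0) := by
  have e : ∀ T : ℝ, ∫ t in (-T)..T, (F (γ t + 1) - F (γ t)) * deriv γ t =
      (G (γ T + 1) - G (γ T)) - (G (γ (-T) + 1) - G (γ (-T))) := fun T =>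
    hγ.integral_deriv_comp (F := fun z => F (z + 1) - F z) (G := fun z => G (z + 1) - G z)
      (fun t => ((h1 t).comp_add_const (γ t) 1).sub (h0 t)) (c1.sub c0) _ _
  obtain ⟨M, hM⟩ := hγ.exists_im_sub_le
  rw [Metric.tendsto_atTop]
  intro ε hε
  obtain ⟨Y, hY⟩ := hG (ε / 3) (by positivity)
  refine ⟨Y + M, fun T hT => ?_⟩
  rw [e, dist_zero_right]
  have a1 := hY (γ T) (hR T) (by
    have := abs_le.1 (hM T); have := le_abs_self (γ T).im; linarith)
  have a2 := hY (γ (-T)) (hR (-T)) (by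
    have := abs_le.1 (hM (-T)); have := neg_le_abs (γ (-T)).im; linarith)
  have := norm_sub_le (G (γ T + 1) - G (γ T)) (G (γ (-T) + 1) - G (γ (-T)))
  linarith

/-- A holomorphic function on the convex strip has a primitive `G`, and `G (z+1) - G z` is small
because `F` is small on the horizontal segment from `z` to `z+1`. -/
theorem tendsto_shift_of_differentiableOn (hγ : IsVerticalContour γ)
    {R : ℝ} (hR : ∀ t, |(γ t).re| + 1 < R) {F : ℂ → ℂ}
    (hF : DifferentiableOn ℂ F (vStrip R)) (h0 : Tendsto F (vEnds R) (𝓝 0)) :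
    Tendsto (fun T : ℝ => ∫ t in (-T)..T, (F (γ t + 1) - F (γ t)) * deriv γ t) atTop (𝓝 0) := by
  obtain ⟨G, hG⟩ := (convex_vStrip R).exists_forall_hasDerivWithinAt hF
  have hG' : ∀ z ∈ vStrip R, HasDerivAt G (F z) z := fun z hz =>
    (hG z hz).hasDerivAt ((isOpen_vStrip R).mem_nhds hz)
  refine hγ.tendsto_shift_of_primitive hR (G := G)
    (fun t => hG' _ (mem_vStrip_of_add_one (hR t))) (fun t => hG' _ (add_one_mem_vStrip (hR t)))
    (hF.continuousOn.comp_continuous hγ.continuous fun t => mem_vStrip_of_add_one (hR t))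
    (hF.continuousOn.comp_continuous (hγ.continuous.add continuous_const)
      fun t => add_one_mem_vStrip (hR t)) fun ε hε => ?_
  obtain ⟨Y, hY⟩ := eventually_vEnds.1 (h0.norm.eventually (ge_mem_nhds (by simpa using hε)))
  refine ⟨Y, fun z hz hzY => ?_⟩
  have hconv : Convex ℝ (vStrip R ∩ {w | w.im = z.im}) :=
    (convex_vStrip R).inter ((convex_singleton z.im).linear_preimage Complex.imLm)
  have := hconv.norm_image_sub_le_of_norm_hasDerivWithin_le (f := G) (f' := F) (C := ε)
    (fun w hw => (hG' w hw.1).hasDerivWithinAt) (fun w hw => hY w hw.1 (by rw [hw.2]; exact hzY))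
    ⟨mem_vStrip_of_add_one hz, rfl⟩ ⟨add_one_mem_vStrip hz, by simp⟩
  simpa using this

end IsVerticalContour

/-- The points `p` and `p - 1` lie on the same side of the contour. -/
structure SameSide (γ : ℝ → ℂ) (p : ℂ) : Prop where
  ne : ∀ t, γ t ≠ p
  ne_sub : ∀ t, γ t + 1 ≠ p
  tendsto : Tendsto (fun T : ℝ => ∫ t in (-T)..T, ((γ t + 1 - p)⁻¹ - (γ t - p)⁻¹) * deriv γ t)
    atTop (𝓝 0)

/-- Translating the contour by `1` amounts to moving the pole from `p` to `p - 1`, so the limit is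
the difference of two principal values. -/
theorem IsVerticalContour.tendsto_inv_shift {γ : ℝ → ℂ} (hγ : IsVerticalContour γ) {p u v : ℂ}
    (hp : ∀ t, γ t ≠ p) (hp' : ∀ t, γ t ≠ p - 1)
    (hu : Tendsto (fun T : ℝ => (2 * Real.pi * Complex.I)⁻¹ *
      ∫ t in (-T)..T, deriv γ t / (γ t - p)) atTop (𝓝 u))
    (hv : Tendsto (fun T : ℝ => (2 * Real.pi * Complex.I)⁻¹ *
      ∫ t in (-T)..T, deriv γ t / (γ t - (p - 1))) atTop (𝓝 v)) :
    Tendsto (fun T : ℝ => ∫ t in (-T)..T, ((γ t + 1 - p)⁻¹ - (γ t - p)⁻¹) * deriv γ t)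
      atTop (𝓝 (2 * Real.pi * Complex.I * (v - u))) := by
  refine ((hv.sub hu).const_mul (2 * Real.pi * Complex.I)).congr fun T => ?_
  have e : ∀ t, γ t + 1 - p = γ t - (p - 1) := fun t => by ring
  have hc : ∀ q, (∀ t, γ t ≠ q) → Continuous fun t => (γ t - q)⁻¹ := fun q hq =>
    (hγ.continuous.sub continuous_const).inv₀ fun t => sub_ne_zero.2 (hq t)
  simp only [e, sub_mul]
  rw [intervalIntegral.integral_sub (hγ.intervalIntegrable_mul_deriv (hc _ hp') _ _)
    (hγ.intervalIntegrable_mul_deriv (hc _ hp) _ _)]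
  simp only [div_eq_inv_mul]
  have := Complex.two_pi_I_ne_zero
  rw [← mul_sub, mul_inv_cancel_left₀ this]

theorem sameSide_of_isRightOf {γ : ℝ → ℂ} (hγ : IsVerticalContour γ) {p : ℂ}
    (h : IsRightOf γ p) (h' : IsRightOf γ (p - 1)) : SameSide γ p where
  ne := h.1
  ne_sub t ht := h'.1 t (eq_sub_of_add_eq ht)
  tendsto := by simpa using hγ.tendsto_inv_shift h.1 h'.1 h.2 h'.2

theorem sameSide_of_isLeftOf {γ : ℝ → ℂ} (hγ : IsVerticalContour γ) {p : ℂ}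
    (h : IsLeftOf γ p) (h' : IsLeftOf γ (p - 1)) : SameSide γ p where
  ne := h.1
  ne_sub t ht := h'.1 t (eq_sub_of_add_eq ht)
  tendsto := by simpa using hγ.tendsto_inv_shift h.1 h'.1 h.2 h'.2

/-- The assumption on sides is needed only for the simple pole. Higher powers have a single-valued
primitive tending to `0` at both ends. -/
theorem SameSide.tendsto_pow {γ : ℝ → ℂ} (hγ : IsVerticalContour γ) {p : ℂ} (h : SameSide γ p)
    (j : ℕ) :
    Tendsto (fun T : ℝ => ∫ t in (-T)..T,
      ((γ t + 1 - p)⁻¹ ^ (j + 1) - (γ t - p)⁻¹ ^ (j + 1)) * deriv γ t) atTop (𝓝 0) := by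
  cases j with
  | zero => simpa using h.tendsto
  | succ j =>
    obtain ⟨R, hR⟩ := hγ.exists_re_lt
    have hd : ∀ z, z ≠ p → HasDerivAt (fun z => -((j : ℂ) + 1)⁻¹ * (z - p)⁻¹ ^ (j + 1))
        ((z - p)⁻¹ ^ (j + 1 + 1)) z := by
      intro z hz
      have hz' := sub_ne_zero.2 hz
      have hj : (j : ℂ) + 1 ≠ 0 := by exact_mod_cast j.succ_ne_zero
      have := ((((hasDerivAt_id z).sub_const p).inv hz').pow (j + 1)).const_mul (-((j : ℂ) + 1)⁻¹)
      refine this.congr_deriv ?_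
      push_cast
      simp only [id, Pi.inv_apply, pow_succ]
      field_simp
    refine hγ.tendsto_shift_of_primitive hR (F := fun z => (z - p)⁻¹ ^ (j + 1 + 1))
      (fun t => hd _ (h.ne t)) (fun t => hd _ (h.ne_sub t)) ?_ ?_ fun ε hε => ?_
    · exact ((hγ.continuous.sub continuous_const).inv₀ fun t => sub_ne_zero.2 (h.ne t)).pow _
    · exact (((hγ.continuous.add continuous_const).sub continuous_const).inv₀
        fun t => sub_ne_zero.2 (h.ne_sub t)).pow _
    · have h1 : Tendsto (fun z => -((j : ℂ) + 1)⁻¹ * (z - p)⁻¹ ^ (j + 1)) (vEnds R) (𝓝 0) := by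
        simpa using ((tendsto_inv_sub_vEnds R p).pow (j + 1)).const_mul (-((j : ℂ) + 1)⁻¹)
      obtain ⟨Y, hY⟩ := eventually_vEnds.1
        (h1.norm.eventually (ge_mem_nhds (by rw [norm_zero]; exact half_pos hε)))
      refine ⟨Y, fun z hz hzY => ?_⟩
      have a1 := hY z (mem_vStrip_of_add_one hz) hzY
      have a2 := hY (z + 1) (add_one_mem_vStrip hz) (by simpa using hzY)
      refine (norm_sub_le _ _).trans ?_
      linarith

/-- A holomorphic function vanishing at `p` is divisible by `z - p`. -/
theorem exists_sub_mul_of_eq_zero {U : Set ℂ} (hU : IsOpen U) {H : ℂ → ℂ}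
    (hH : DifferentiableOn ℂ H U) {p : ℂ} (h0 : H p = 0) :
    ∃ K : ℂ → ℂ, DifferentiableOn ℂ K U ∧ ∀ z, H z = (z - p) * K z := by
  refine ⟨dslope H p, ?_, fun z => by have := sub_smul_dslope_of_zero h0 z; simpa using this.symm⟩
  -- The point `p` need not lie in `U`: roots of the denominator outside the strip are split off in
  -- the same way.
  by_cases hp : p ∈ U
  · exact (Complex.differentiableOn_dslope (hU.mem_nhds hp)).2 hH
  · exact (differentiableOn_dslope_of_notMem hp).2 hH

/-- Splitting off the leading polar part of `H / ((z - p) ^ (j + 1) P)` at `p`. -/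
theorem tendsto_shift_step {γ : ℝ → ℂ} (hγ : IsVerticalContour γ) {R : ℝ}
    (hR : ∀ t, |(γ t).re| + 1 < R) {H : ℂ → ℂ} {Q Q' P : ℂ[X]} {p w : ℂ} {j : ℕ}
    (hQ' : Q' = (X - C p) ^ j * P) (hQQ' : Q = (X - C p) * Q') (hPp : P.eval p ≠ 0)
    (hH : DifferentiableOn ℂ H (vStrip R))
    (hne : ∀ t, Q.eval (γ t) ≠ 0) (hne1 : ∀ t, Q.eval (γ t + 1) ≠ 0)
    (h0 : Tendsto (fun z => H z / Q.eval z) (vEnds R) (𝓝 0))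
    (hw : Tendsto (fun T : ℝ => ∫ t in (-T)..T,
      ((γ t + 1 - p)⁻¹ ^ (j + 1) - (γ t - p)⁻¹ ^ (j + 1)) * deriv γ t) atTop (𝓝 w))
    (ih : ∀ K : ℂ → ℂ, DifferentiableOn ℂ K (vStrip R) →
      Tendsto (fun z => K z / Q'.eval z) (vEnds R) (𝓝 0) →
      Tendsto (fun T : ℝ => ∫ t in (-T)..T,
        (K (γ t + 1) / Q'.eval (γ t + 1) - K (γ t) / Q'.eval (γ t)) * deriv γ t) atTop (𝓝 0)) :
    Tendsto (fun T : ℝ => ∫ t in (-T)..T,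
      (H (γ t + 1) / Q.eval (γ t + 1) - H (γ t) / Q.eval (γ t)) * deriv γ t) atTop
      (𝓝 (H p / P.eval p * w)) := by
  have hQ : Q ≠ 0 := fun h => hne 0 (by simp [h])
  have hP : Q = (X - C p) ^ (j + 1) * P := by rw [hQQ', hQ']; ring
  obtain ⟨c, hc⟩ : ∃ c, c = H p / P.eval p := ⟨_, rfl⟩
  rw [← hc]
  -- With `c = H p / P p` the numerator `H - c P` vanishes at `p`, so one factor `z - p` cancels and
  -- the rest has the denominator `Q'`.
  obtain ⟨K, hK, hKH⟩ := exists_sub_mul_of_eq_zero (isOpen_vStrip R)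
    (H := fun z => H z - c * P.eval z) (p := p)
    (hH.sub ((P.differentiable.differentiableOn).const_mul c)) (by simp [hc, hPp])
  have hpt : ∀ z, Q.eval z ≠ 0 →
      H z / Q.eval z = K z / Q'.eval z + c * (z - p)⁻¹ ^ (j + 1) := by
    intro z hz
    have h1 := hKH z
    rw [hP] at hz
    simp only [eval_mul, eval_pow, eval_sub, eval_X, eval_C] at hz
    have hz1 : (z - p) ≠ 0 := fun h => hz (by simp [h])
    have hz2 : P.eval z ≠ 0 := fun h => hz (by simp [h])
    rw [hP, hQ']
    simp only [eval_mul, eval_pow, eval_sub, eval_X, eval_C]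
    rw [inv_pow]
    field_simp
    linear_combination (z - p) ^ j * h1
  have hev : ∀ᶠ z in vEnds R, Q.eval z ≠ 0 := by
    have hfin : (Q.roots.toFinset : Set ℂ).Finite := Finset.finite_toSet _
    obtain ⟨B, hB⟩ := hfin.isBounded.exists_norm_le
    filter_upwards [(tendsto_norm_vEnds R).eventually (eventually_gt_atTop B)] with z hz h
    have := hB z (by simpa [hQ] using h)
    linarith
  have hpow : Tendsto (fun z => c * (z - p)⁻¹ ^ (j + 1)) (vEnds R) (𝓝 0) := by
    simpa using ((tendsto_inv_sub_vEnds R p).pow (j + 1)).const_mul c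
  have hlim : Tendsto (fun z => K z / Q'.eval z) (vEnds R) (𝓝 0) := by
    have := h0.sub hpow
    rw [sub_zero] at this
    refine this.congr' ?_
    filter_upwards [hev] with z hz
    rw [hpt z hz]; ring
  have hmain := (ih K hK hlim).add (hw.const_mul c)
  rw [zero_add] at hmain
  have hQe : ∀ z, Q.eval z = (z - p) * Q'.eval z := fun z => by rw [hQQ']; simp
  have hne' : ∀ t, Q'.eval (γ t) ≠ 0 := fun t ht => hne t (by rw [hQe, ht, mul_zero])
  have hne1' : ∀ t, Q'.eval (γ t + 1) ≠ 0 := fun t ht => hne1 t (by rw [hQe, ht, mul_zero])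
  have hp1 : ∀ t, γ t - p ≠ 0 := fun t ht => hne t (by rw [hQe, ht, zero_mul])
  have hp2 : ∀ t, γ t + 1 - p ≠ 0 := fun t ht => hne1 t (by rw [hQe, ht, zero_mul])
  have hγ1 : Continuous fun t => γ t + 1 := hγ.continuous.add continuous_const
  refine hmain.congr fun T => ?_
  rw [← intervalIntegral.integral_const_mul, ← intervalIntegral.integral_add]
  · refine intervalIntegral.integral_congr fun t _ => ?_
    rw [hpt _ (hne t), hpt _ (hne1 t)]
    ring
  · refine hγ.intervalIntegrable_mul_deriv (Continuous.sub ?_ ?_) _ _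
    · exact (hK.continuousOn.comp_continuous hγ1 fun t => add_one_mem_vStrip (hR t)).div
        (Q'.continuous.comp hγ1) hne1'
    · exact (hK.continuousOn.comp_continuous hγ.continuous
        fun t => mem_vStrip_of_add_one (hR t)).div (Q'.continuous.comp hγ.continuous) hne'
  · refine (hγ.intervalIntegrable_mul_deriv (Continuous.sub ?_ ?_) _ _).const_mul c
    · exact ((hγ1.sub continuous_const).inv₀ hp2).pow _
    · exact ((hγ.continuous.sub continuous_const).inv₀ hp1).pow _

/-- Contour shift for a meromorphic function `H / Q` all of whose poles `p` lie on the same side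
of the contour as `p - 1`. -/
theorem tendsto_shift_of_sameSide {γ : ℝ → ℂ} (hγ : IsVerticalContour γ) {R : ℝ}
    (hR : ∀ t, |(γ t).re| + 1 < R) (n : ℕ) : ∀ (H : ℂ → ℂ) (Q : ℂ[X]), Q.natDegree = n → Q ≠ 0 →
    DifferentiableOn ℂ H (vStrip R) → (∀ p, Q.IsRoot p → SameSide γ p) →
    Tendsto (fun z => H z / Q.eval z) (vEnds R) (𝓝 0) →
    Tendsto (fun T : ℝ => ∫ t in (-T)..T,
      (H (γ t + 1) / Q.eval (γ t + 1) - H (γ t) / Q.eval (γ t)) * deriv γ t) atTop (𝓝 0) := by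
  induction n with
  | zero =>
    intro H Q hn hQ hH _ h0
    obtain ⟨q, rfl⟩ : ∃ q, Q = C q := ⟨_, eq_C_of_natDegree_eq_zero hn⟩
    simp only [eval_C] at h0 ⊢
    exact hγ.tendsto_shift_of_differentiableOn hR (F := fun z => H z / q) (hH.div_const q) h0
  | succ n ih =>
    intro H Q hn hQ hH hs h0
    obtain ⟨p, hp⟩ := Complex.exists_root (f := Q) (natDegree_pos_iff_degree_pos.1 (by omega))
    obtain ⟨P, hP, hPp⟩ := exists_eq_pow_rootMultiplicity_mul_and_not_dvd Q hQ p
    obtain ⟨j, hj⟩ : ∃ j, Q.rootMultiplicity p = j + 1 :=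
      Nat.exists_eq_succ_of_ne_zero ((rootMultiplicity_pos hQ).2 hp).ne'
    rw [hj] at hP
    rw [dvd_iff_isRoot, IsRoot.def] at hPp
    obtain ⟨Q', hQ'⟩ : ∃ Q', Q' = (X - C p) ^ j * P := ⟨_, rfl⟩
    have hQQ' : Q = (X - C p) * Q' := by rw [hP, hQ']; ring
    have hQ'0 : Q' ≠ 0 := fun h => hQ (by rw [hQQ', h, mul_zero])
    have hdeg : Q'.natDegree = n := by
      rw [hQQ', natDegree_mul (X_sub_C_ne_zero p) hQ'0, natDegree_X_sub_C] at hn; omega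
    have hroot : ∀ q, Q'.IsRoot q → SameSide γ q := fun q hq =>
      hs q (by rw [hQQ', IsRoot.def, eval_mul, hq.eq_zero, mul_zero])
    rw [← mul_zero (H p / P.eval p)]
    exact tendsto_shift_step hγ hR hQ' hQQ' hPp hH (fun t ht => (hs _ ht).ne t rfl)
      (fun t ht => (hs _ ht).ne_sub t rfl) h0 ((hs p hp).tendsto_pow hγ j)
      fun K hK hlim => ih K Q' hdeg hQ'0 hK hroot hlim

/-- Contour shift across a simple pole `p` of `H / ((z - p) P)`, where `p` is to the right and
`p - 1` to the left of the contour. -/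
theorem tendsto_shift_of_simple_pole {γ : ℝ → ℂ} (hγ : IsVerticalContour γ) {R : ℝ}
    (hR : ∀ t, |(γ t).re| + 1 < R) {H : ℂ → ℂ} {P : ℂ[X]} {p : ℂ} (hP : P ≠ 0)
    (hH : DifferentiableOn ℂ H (vStrip R)) (hs : ∀ q, P.IsRoot q → SameSide γ q)
    (hp : IsRightOf γ p) (hp' : IsLeftOf γ (p - 1))
    (h0 : Tendsto (fun z => H z / ((X - C p) * P).eval z) (vEnds R) (𝓝 0)) :
    P.eval p ≠ 0 ∧ Tendsto (fun T : ℝ => ∫ t in (-T)..T,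
      (H (γ t + 1) / ((X - C p) * P).eval (γ t + 1) -
        H (γ t) / ((X - C p) * P).eval (γ t)) * deriv γ t) atTop
      (𝓝 (H p / P.eval p * (2 * Real.pi * Complex.I))) := by
  have hw := hγ.tendsto_inv_shift hp.1 hp'.1 hp.2 hp'.2
  rw [show (1 / 2 : ℂ) - -1 / 2 = 1 by norm_num, mul_one] at hw
  -- A root of `P` at `p` would put `p` and `p - 1` on the same side, giving the limit `0` instead
  -- of `2πi`.
  have hPp : P.eval p ≠ 0 := fun h =>
    Complex.two_pi_I_ne_zero (tendsto_nhds_unique hw (hs p h).tendsto)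
  refine ⟨hPp, tendsto_shift_step hγ hR (j := 0) (by simp) rfl hPp hH (fun t ht => ?_)
    (fun t ht => ?_) h0 (by simpa using hw)
    fun K hK hlim => tendsto_shift_of_sameSide hγ hR _ K P rfl hP hK hs hlim⟩
  · rw [eval_mul, mul_eq_zero] at ht
    rcases ht with ht | ht
    · exact hp.1 t (by simpa [sub_eq_zero] using ht)
    · exact (hs _ ht).ne t rfl
  · rw [eval_mul, mul_eq_zero] at ht
    rcases ht with ht | ht
    · exact hp'.1 t (by
        simp only [eval_sub, eval_X, eval_C] at ht
        linear_combination ht)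
    · exact (hs _ ht).ne_sub t rfl

/-! ### Products of Gamma functions along vertical contours -/

theorem norm_Gamma_le_Gamma_re {s : ℂ} (hs : 0 < s.re) :
    ‖Complex.Gamma s‖ ≤ Real.Gamma s.re := by
  rw [Complex.Gamma_eq_integral hs, Real.Gamma_eq_integral hs]
  refine (norm_integral_le_integral_norm _).trans_eq ?_
  refine setIntegral_congr_fun measurableSet_Ioi fun x hx => ?_
  rw [norm_mul, Complex.norm_of_nonneg (Real.exp_pos _).le,
    Complex.norm_cpow_eq_rpow_re_of_pos hx]
  simp

theorem Gamma_eq_Gamma_add_div_poch (s : ℂ) (m : ℕ) :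
    Complex.Gamma s = Complex.Gamma (s + m) / poch s m := by
  induction m with
  | zero => simp [poch_zero]
  | succ m ih =>
    rw [ih, poch_succ]
    -- At a pole both sides are `0`, since `Γ` takes the value `0` there and division by zero gives
    -- `0`. Hence the identity is unconditional.
    by_cases h : s + m = 0
    · rw [h, Complex.Gamma_zero, mul_zero, div_zero, zero_div]
    · push_cast
      rw [← add_assoc, Complex.Gamma_add_one _ h, mul_comm (poch s m), mul_div_mul_left _ _ h]

theorem norm_im_pow_le_norm_poch (s : ℂ) (m : ℕ) : |s.im| ^ m ≤ ‖poch s m‖ := by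
  induction m with
  | zero => simp [poch_zero]
  | succ m ih =>
    rw [poch_succ, norm_mul, pow_succ]
    refine mul_le_mul ih ?_ (abs_nonneg _) (norm_nonneg _)
    simpa using Complex.abs_im_le_norm (s + m)

/-- The Gamma function decays faster than any power at the ends of a vertical strip. -/
theorem exists_norm_Gamma_le (R : ℝ) (m : ℕ) :
    ∃ K : ℝ, 0 ≤ K ∧ ∀ s : ℂ, |s.re| ≤ R → 1 ≤ |s.im| → ‖Complex.Gamma s‖ ≤ K / |s.im| ^ m := by
  -- `M ≥ R + 1` moves `s + M` into `1 ≤ Re ≤ R + M`, where `Γ` is bounded by a compactness argument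
  -- on the real axis; `M ≥ m` supplies the required power of `|Im s|` from `(s)_M`.
  obtain ⟨M, hM⟩ := exists_nat_ge (max (R + 1) m)
  have hMR : R + 1 ≤ M := (le_max_left _ _).trans hM
  have hMm : m ≤ M := by exact_mod_cast (le_max_right _ _).trans hM
  have hc : ContinuousOn Real.Gamma (Set.Icc 1 (R + M)) := fun x hx =>
    (Real.differentiableOn_Gamma_Ioi.continuousOn x
      (lt_of_lt_of_le one_pos hx.1)).mono fun y hy => lt_of_lt_of_le one_pos hy.1
  obtain ⟨K, hK⟩ := isCompact_Icc.exists_bound_of_continuousOn hc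
  refine ⟨max K 0, le_max_right _ _, fun s hs hs1 => ?_⟩
  have hre := abs_le.1 hs
  have h1 : (s + M).re = s.re + M := by simp
  have hpos : 0 < |s.im| ^ m := pow_pos (lt_of_lt_of_le one_pos hs1) m
  have h2 : ‖Complex.Gamma (s + M)‖ ≤ max K 0 := by
    refine (norm_Gamma_le_Gamma_re (by rw [h1]; linarith)).trans ?_
    rw [h1]
    exact (Real.le_norm_self _).trans ((hK _ ⟨by linarith, by linarith⟩).trans (le_max_left _ _))
  rw [Gamma_eq_Gamma_add_div_poch s M, norm_div]
  exact div_le_div₀ (le_max_right _ _) h2 hpos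
    ((pow_le_pow_right₀ hs1 hMm).trans (norm_im_pow_le_norm_poch s M))

theorem tendsto_abs_im_vEnds (R : ℝ) : Tendsto (fun z : ℂ => |z.im|) (vEnds R) atTop :=
  tendsto_comap.mono_left inf_le_left

theorem tendsto_pow_mul_Gamma_add (R : ℝ) (a : ℂ) (m : ℕ) :
    Tendsto (fun z : ℂ => ‖z‖ ^ m * ‖Complex.Gamma (a + z)‖) (vEnds R) (𝓝 0) := by
  -- One power more than `m`, so that a factor tending to `0` remains after absorbing `‖z‖ ^ m`.
  obtain ⟨K, hK0, hK⟩ := exists_norm_Gamma_le (R + |a.re|) (m + 1)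
  have hb : Tendsto (fun z : ℂ => K * (R + 1 + 2 * |a.im| + 2) ^ m * (|z.im| - |a.im|)⁻¹)
      (vEnds R) (𝓝 0) := by
    rw [← mul_zero (K * (R + 1 + 2 * |a.im| + 2) ^ m)]
    exact (tendsto_inv_atTop_zero.comp
      (tendsto_atTop_add_const_right _ (-|a.im|) (tendsto_abs_im_vEnds R))).const_mul _
  refine squeeze_zero' (Eventually.of_forall fun z => by positivity) ?_ hb
  have hs : ∀ᶠ z in vEnds R, z ∈ vStrip R := mem_inf_of_right (mem_principal_self _)
  filter_upwards [hs, (tendsto_abs_im_vEnds R).eventually (eventually_ge_atTop (|a.im| + 1))]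
    with z hz hzi
  have hz' : |z.re| < R := hz
  have hR : 0 < R := (abs_nonneg _).trans_lt hz'
  have h1 : |z.im| - |a.im| ≤ |(a + z).im| := by
    have := abs_sub_abs_le_abs_sub z.im (-a.im)
    rw [abs_neg, sub_neg_eq_add] at this
    rw [Complex.add_im, add_comm]
    linarith
  have h2 := hK (a + z) (by
    rw [Complex.add_re]; exact (abs_add_le _ _).trans (by linarith)) (by linarith)
  have h3 : ‖z‖ ≤ (R + 1 + 2 * |a.im| + 2) * (|z.im| - |a.im|) := by
    have h4 := Complex.norm_le_abs_re_add_abs_im z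
    have h5 := abs_nonneg a.im
    nlinarith
  set y := |z.im| - |a.im| with hy
  have hy1 : 1 ≤ y := by linarith
  have h6 : ‖Complex.Gamma (a + z)‖ ≤ K / y ^ (m + 1) :=
    h2.trans (div_le_div_of_nonneg_left hK0 (by positivity) (pow_le_pow_left₀ (by linarith) h1 _))
  calc ‖z‖ ^ m * ‖Complex.Gamma (a + z)‖
      ≤ ((R + 1 + 2 * |a.im| + 2) * y) ^ m * (K / y ^ (m + 1)) :=
        mul_le_mul (pow_le_pow_left₀ (norm_nonneg _) h3 _) h6 (norm_nonneg _) (by positivity)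
    _ = K * (R + 1 + 2 * |a.im| + 2) ^ m * y⁻¹ := by
        rw [mul_pow, pow_succ]; field_simp

theorem tendsto_neg_vEnds (R : ℝ) : Tendsto (fun z : ℂ => -z) (vEnds R) (vEnds R) := by
  refine tendsto_inf.2 ⟨tendsto_comap_iff.2 ?_, tendsto_principal.2 ?_⟩
  · exact (tendsto_abs_im_vEnds R).congr fun z => by simp
  · filter_upwards [mem_inf_of_right (mem_principal_self (vStrip R))] with z hz
    simpa [vStrip] using hz

theorem tendsto_Gamma_add (R : ℝ) (a : ℂ) :
    Tendsto (fun z : ℂ => Complex.Gamma (a + z)) (vEnds R) (𝓝 0) := by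
  rw [tendsto_zero_iff_norm_tendsto_zero]
  simpa using tendsto_pow_mul_Gamma_add R a 0

theorem tendsto_Gamma_sub (R : ℝ) (a : ℂ) :
    Tendsto (fun z : ℂ => Complex.Gamma (a - z)) (vEnds R) (𝓝 0) := by
  simpa [Function.comp_def, sub_eq_add_neg] using (tendsto_Gamma_add R a).comp (tendsto_neg_vEnds R)

/-- The Mellin–Barnes product `Γ(a+z) Γ(b+z) Γ(c-z) Γ(d-z)`. -/
def gammaProd (a b c d z : ℂ) : ℂ :=
  Complex.Gamma (a + z) * Complex.Gamma (b + z) * Complex.Gamma (c - z) * Complex.Gamma (d - z)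

theorem tendsto_eval_mul_gammaProd (R : ℝ) (a b c d : ℂ) (p : ℂ[X]) :
    Tendsto (fun z => p.eval z * gammaProd a b c d z) (vEnds R) (𝓝 0) := by
  have h1 : Tendsto (fun z => p.eval z * Complex.Gamma (a + z)) (vEnds R) (𝓝 0) := by
    simp only [eval_eq_sum_range, Finset.sum_mul]
    rw [← Finset.sum_const_zero (s := Finset.range (p.natDegree + 1))]
    refine tendsto_finsetSum _ fun m _ => ?_
    rw [tendsto_zero_iff_norm_tendsto_zero]
    simpa [mul_assoc] using (tendsto_pow_mul_Gamma_add R a m).const_mul ‖p.coeff m‖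
  simpa [gammaProd, mul_assoc] using
    ((h1.mul (tendsto_Gamma_add R b)).mul (tendsto_Gamma_sub R c)).mul (tendsto_Gamma_sub R d)

/-- The denominator of `Γ(a+z) Γ(b+z) Γ(c-z) Γ(d-z)` after extracting `m` poles from each factor. -/
def gammaDenom (a b c d : ℂ) (m : ℕ) : ℂ[X] :=
  (ascPochhammer ℂ m).comp (X + C a) * (ascPochhammer ℂ m).comp (X + C b) *
    (ascPochhammer ℂ m).comp (C c - X) * (ascPochhammer ℂ m).comp (C d - X)

theorem eval_gammaDenom (a b c d : ℂ) (m : ℕ) (z : ℂ) :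
    (gammaDenom a b c d m).eval z =
      poch (a + z) m * poch (b + z) m * poch (c - z) m * poch (d - z) m := by
  simp [gammaDenom, poch, add_comm z]

theorem gammaProd_eq_div (a b c d : ℂ) (m : ℕ) (z : ℂ) :
    gammaProd a b c d z =
      gammaProd (a + m) (b + m) (c + m) (d + m) z / (gammaDenom a b c d m).eval z := by
  rw [eval_gammaDenom, gammaProd, gammaProd, Gamma_eq_Gamma_add_div_poch (a + z) m,
    Gamma_eq_Gamma_add_div_poch (b + z) m, Gamma_eq_Gamma_add_div_poch (c - z) m,
    Gamma_eq_Gamma_add_div_poch (d - z) m, add_right_comm a, add_right_comm b,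
    sub_add_eq_add_sub, sub_add_eq_add_sub, div_mul_div_comm, div_mul_div_comm, div_mul_div_comm]

theorem gammaDenom_root {a b c d : ℂ} {m : ℕ} {z : ℂ} (h : (gammaDenom a b c d m).IsRoot z) :
    ∃ k : ℕ, z = -a - k ∨ z = -b - k ∨ z = c + k ∨ z = d + k := by
  rw [IsRoot.def, eval_gammaDenom] at h
  simp only [mul_eq_zero, poch_eq_zero_iff] at h
  rcases h with ((⟨k, -, h⟩ | ⟨k, -, h⟩) | ⟨k, -, h⟩) | ⟨k, -, h⟩ <;> refine ⟨k, ?_⟩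
  · exact Or.inl (by linear_combination h)
  · exact Or.inr (Or.inl (by linear_combination h))
  · exact Or.inr (Or.inr (Or.inl (by linear_combination -h)))
  · exact Or.inr (Or.inr (Or.inr (by linear_combination -h)))

theorem gammaDenom_ne_zero (a b c d : ℂ) (m : ℕ) : gammaDenom a b c d m ≠ 0 := by
  have h1 : ∀ q : ℂ[X], q.natDegree = 1 → (ascPochhammer ℂ m).comp q ≠ 0 := fun q hq h => by
    rcases comp_eq_zero_iff.1 h with h | h
    · exact (monic_ascPochhammer ℂ m).ne_zero h
    · rw [h.2, natDegree_C] at hq; exact zero_ne_one hq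
  have h2 : ∀ e : ℂ, (C e - X : ℂ[X]).natDegree = 1 := fun e => by
    rw [← neg_sub, natDegree_neg, natDegree_X_sub_C]
  exact mul_ne_zero (mul_ne_zero (mul_ne_zero (h1 _ (natDegree_X_add_C a))
    (h1 _ (natDegree_X_add_C b))) (h1 _ (h2 c))) (h1 _ (h2 d))

theorem Gamma_differentiableAt_of_re_pos {s : ℂ} (hs : 0 < s.re) :
    DifferentiableAt ℂ Complex.Gamma s :=
  Complex.differentiableAt_Gamma s fun m h => by
    rw [h, Complex.neg_re, Complex.natCast_re] at hs
    have : (0 : ℝ) ≤ m := m.cast_nonneg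
    linarith

theorem differentiableOn_gammaProd {R : ℝ} {a b c d : ℂ} (ha : R < a.re) (hb : R < b.re)
    (hc : R < c.re) (hd : R < d.re) : DifferentiableOn ℂ (gammaProd a b c d) (vStrip R) := by
  intro z hz
  have hz' := abs_lt.1 (show |z.re| < R from hz)
  have h1 : ∀ e : ℂ, R < e.re → DifferentiableAt ℂ (fun z => Complex.Gamma (e + z)) z := fun e he =>
    (Gamma_differentiableAt_of_re_pos (by rw [Complex.add_re]; linarith)).comp z
      (differentiableAt_id.const_add e)
  have h2 : ∀ e : ℂ, R < e.re → DifferentiableAt ℂ (fun z => Complex.Gamma (e - z)) z := fun e he =>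
    (Gamma_differentiableAt_of_re_pos (by rw [Complex.sub_re]; linarith)).comp z
      (differentiableAt_id.const_sub e)
  exact ((((h1 a ha).mul (h1 b hb)).mul (h2 c hc)).mul (h2 d hd)).differentiableWithinAt

theorem gammaProd_ne_zero_of_re_pos {a b c d : ℂ} (ha : 0 < a.re) (hb : 0 < b.re)
    (hc : 0 < c.re) (hd : 0 < d.re) : gammaProd a b c d 0 ≠ 0 := by
  simp only [gammaProd, add_zero, sub_zero]
  exact mul_ne_zero (mul_ne_zero (mul_ne_zero (Complex.Gamma_ne_zero_of_re_pos ha)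
    (Complex.Gamma_ne_zero_of_re_pos hb)) (Complex.Gamma_ne_zero_of_re_pos hc))
    (Complex.Gamma_ne_zero_of_re_pos hd)

theorem exists_nat_shift_re (R : ℝ) (a b c d : ℂ) : ∃ m : ℕ,
    R < (a + m).re ∧ R < (b + m).re ∧ R < (c + m).re ∧ R < (d + m).re := by
  obtain ⟨m, hm⟩ := exists_nat_gt (R + |a.re| + |b.re| + |c.re| + |d.re|)
  have ha := neg_abs_le a.re
  have hb := neg_abs_le b.re
  have hc := neg_abs_le c.re
  have hd := neg_abs_le d.re
  have ha' := abs_nonneg a.re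
  have hb' := abs_nonneg b.re
  have hc' := abs_nonneg c.re
  have hd' := abs_nonneg d.re
  refine ⟨m, ?_, ?_, ?_, ?_⟩ <;> rw [Complex.add_re, Complex.natCast_re] <;> linarith

/-- A polynomial times a Mellin–Barnes product is absolutely integrable along a vertical contour
that avoids the poles. -/
theorem IsVerticalContour.integrable_gammaProd {γ : ℝ → ℂ} (hγ : IsVerticalContour γ)
    {a b c d : ℂ} (ha : ∀ (k : ℕ) t, γ t ≠ -a - k) (hb : ∀ (k : ℕ) t, γ t ≠ -b - k)
    (hc : ∀ (k : ℕ) t, γ t ≠ c + k) (hd : ∀ (k : ℕ) t, γ t ≠ d + k) (p : ℂ[X]) :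
    Integrable fun t => p.eval (γ t) * gammaProd a b c d (γ t) * deriv γ t := by
  obtain ⟨R, hR⟩ := hγ.exists_re_lt
  have h1 : ∀ e : ℂ, (∀ (k : ℕ) t, γ t ≠ -e - k) →
      Continuous fun t => Complex.Gamma (e + γ t) := fun e he =>
    continuous_iff_continuousAt.2 fun t =>
      ContinuousAt.comp (f := fun t => e + γ t)
        (Complex.continuousAt_Gamma _ fun k h => he k t (by linear_combination h))
        (continuous_const.add hγ.continuous).continuousAt
  have h2 : ∀ e : ℂ, (∀ (k : ℕ) t, γ t ≠ e + k) →
      Continuous fun t => Complex.Gamma (e - γ t) := fun e he =>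
    continuous_iff_continuousAt.2 fun t =>
      ContinuousAt.comp (f := fun t => e - γ t)
        (Complex.continuousAt_Gamma _ fun k h => he k t (by linear_combination -h))
        (continuous_const.sub hγ.continuous).continuousAt
  have hcont : Continuous fun t => p.eval (γ t) * gammaProd a b c d (γ t) :=
    (p.continuous.comp hγ.continuous).mul ((((h1 a ha).mul (h1 b hb)).mul (h2 c hc)).mul (h2 d hd))
  obtain ⟨M, hM⟩ := hγ.velocity_bounded
  obtain ⟨M', hM'⟩ := hγ.exists_im_sub_le
  have hloc : LocallyIntegrable fun t => p.eval (γ t) * gammaProd a b c d (γ t) * deriv γ t := by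
    refine (hcont.norm.mul (continuous_const (y := M))).locallyIntegrable.mono
      (hcont.aestronglyMeasurable.mul (measurable_deriv γ).aestronglyMeasurable)
      (Eventually.of_forall fun t => ?_)
    rw [norm_mul]
    exact (mul_le_mul_of_nonneg_left (hM t) (norm_nonneg _)).trans (Real.le_norm_self _)
  refine hloc.integrable_of_isBigO_cocompact (g := fun t : ℝ => (1 + t ^ 2)⁻¹) ?_
    (integrable_inv_one_add_sq.integrableAtFilter _)
  -- The extra `X ^ 2` gives the bound `‖γ t‖ ^ (-2)`, which is comparable to the integrable `(1 +
  -- t²)⁻¹` because `|t| / 2 ≤ ‖γ t‖` for large `|t|`.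
  have hdec := (tendsto_eval_mul_gammaProd R a b c d (X ^ 2 * p)).norm
  rw [norm_zero] at hdec
  obtain ⟨Y, hY⟩ := eventually_vEnds.1 (hdec.eventually (ge_mem_nhds one_pos))
  refine Asymptotics.IsBigO.of_bound (8 * M) ?_
  have hev : ∀ᶠ t in cocompact ℝ, 2 * |M'| + |Y| + 1 ≤ ‖t‖ :=
    tendsto_norm_cocompact_atTop.eventually (eventually_ge_atTop _)
  filter_upwards [hev] with t ht
  rw [Real.norm_eq_abs] at ht
  have hi : |t| - |M'| ≤ |(γ t).im| := by
    have h3 := abs_sub_abs_le_abs_sub t (γ t).im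
    have h4 := hM' t
    rw [abs_sub_comm] at h4
    linarith [le_abs_self M']
  have h5 := hY (γ t) (mem_vStrip_of_add_one (hR t)) (by
    linarith [le_abs_self Y, abs_nonneg M'])
  have h6 : |t| / 2 ≤ ‖γ t‖ := by
    linarith [Complex.abs_im_le_norm (γ t), abs_nonneg Y]
  have h7 : (1 + t ^ 2) / 8 ≤ ‖γ t‖ ^ 2 := by
    have h8 : 1 ≤ |t| := by linarith [abs_nonneg M', abs_nonneg Y]
    have h9 := pow_le_pow_left₀ (by linarith) h6 2
    have h10 : |t| ^ 2 = t ^ 2 := sq_abs t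
    nlinarith
  simp only [eval_mul, eval_pow, eval_X, norm_mul, norm_pow, mul_assoc] at h5
  have hpos : 0 < 1 + t ^ 2 := by positivity
  rw [norm_mul, norm_inv, Real.norm_of_nonneg hpos.le, norm_mul, ← div_eq_mul_inv, le_div_iff₀ hpos]
  have hM0 : 0 ≤ M := (norm_nonneg _).trans (hM t)
  set u := ‖p.eval (γ t)‖ * ‖gammaProd a b c d (γ t)‖ with hu
  have hu0 : 0 ≤ u := by positivity
  have h11 : (1 + t ^ 2) / 8 * u ≤ 1 := (mul_le_mul_of_nonneg_right h7 hu0).trans h5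
  calc u * ‖deriv γ t‖ * (1 + t ^ 2) ≤ u * M * (1 + t ^ 2) := by gcongr; exact hM t
    _ = 8 * M * ((1 + t ^ 2) / 8 * u) := by ring
    _ ≤ 8 * M * 1 := by gcongr
    _ = 8 * M := mul_one _

/-! ### The continuous part of the inner product -/

theorem hahnOmega_eq_gammaProd (α β : ℂ) (N : ℕ) (z : ℂ) :
    hahnOmega α β N z = gammaProd 1 (α + N + 2) 0 (β + N + 1) z := by
  rw [hahnOmega, gammaProd, zero_sub]; ring

namespace IsSeparatingContour

variable {α β : ℂ} {N : ℕ} {γ : ℝ → ℂ}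

theorem integrable (hγ : IsSeparatingContour α β N γ) (p : ℂ[X]) :
    Integrable fun t => p.eval (γ t) * hahnOmega α β N (γ t) * deriv γ t := by
  simp only [hahnOmega_eq_gammaProd]
  refine hγ.toIsVerticalContour.integrable_gammaProd (fun k => (hγ.left₁ k).1) (fun k t => ?_)
    (fun k t => ?_) (fun k => (hγ.right₂ k).1) p
  · rw [show -(α + N + 2) - (k : ℂ) = -α - N - 2 - k by ring]
    exact (hγ.left₂ k).1 t
  · rw [zero_add]; exact (hγ.right₁ k).1 t

/-- The right-hand sequences start at `1` and `β+N+2`, one step inside those of `ω`. Thus for every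
such pole `p` the point `p - 1` is still a right pole of `ω`; left sequences are stable under `p ↦ p
- 1`. -/
theorem sameSide_root (hγ : IsSeparatingContour α β N γ) {m : ℕ} {z : ℂ}
    (h : (gammaDenom 1 (α + N + 2) 1 (β + N + 1 + 1) m).IsRoot z) : SameSide γ z := by
  have hv := hγ.toIsVerticalContour
  obtain ⟨k, rfl | rfl | rfl | rfl⟩ := gammaDenom_root h
  · have h1 := hγ.left₁ (k + 1)
    refine sameSide_of_isLeftOf hv (hγ.left₁ k) ?_
    convert h1 using 1; push_cast; ring
  · have h0 := hγ.left₂ k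
    have h1 := hγ.left₂ (k + 1)
    refine sameSide_of_isLeftOf hv ?_ ?_
    · convert h0 using 1; ring
    · convert h1 using 1; push_cast; ring
  · have h0 := hγ.right₁ k
    have h1 := hγ.right₁ (k + 1)
    refine sameSide_of_isRightOf hv ?_ ?_
    · convert h1 using 1; push_cast; ring
    · convert h0 using 1; ring
  · have h0 := hγ.right₂ k
    have h1 := hγ.right₂ (k + 1)
    refine sameSide_of_isRightOf hv ?_ ?_
    · convert h1 using 1; push_cast; ring
    · convert h0 using 1; ring

/-- Write `W` for this product. It is the function whose shift difference realises the Pearson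
equation: `W(z)` and `W(z+1)` are both polynomial multiples of `ω(z)`, by the functional equation of
`Γ`. -/
theorem gammaProd_eq (hγ : IsSeparatingContour α β N γ)
    (t : ℝ) : gammaProd 1 (α + N + 2) 1 (β + N + 1 + 1) (γ t) =
    γ t * (γ t - (β + N + 1)) * hahnOmega α β N (γ t) := by
  have h0 : -γ t ≠ 0 := neg_ne_zero.2 (by simpa using (hγ.right₁ 0).1 t)
  have h1 : β + N + 1 - γ t ≠ 0 := sub_ne_zero.2 (Ne.symm (by simpa using (hγ.right₂ 0).1 t))
  rw [hahnOmega_eq_gammaProd, gammaProd, gammaProd, zero_sub,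
    show 1 - γ t = -γ t + 1 by ring, show β + N + 1 + 1 - γ t = β + N + 1 - γ t + 1 by ring,
    Complex.Gamma_add_one _ h0, Complex.Gamma_add_one _ h1]
  ring

theorem gammaProd_add_one_eq (hγ : IsSeparatingContour α β N γ)
    (t : ℝ) : gammaProd 1 (α + N + 2) 1 (β + N + 1 + 1) (γ t + 1) =
    (γ t + 1) * (γ t + (α + N + 2)) * hahnOmega α β N (γ t) := by
  have h0 : 1 + γ t ≠ 0 := fun h => (hγ.left₁ 0).1 t (by push_cast; linear_combination h)
  have h1 : α + N + 2 + γ t ≠ 0 := fun h => (hγ.left₂ 0).1 t (by push_cast; linear_combination h)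
  rw [hahnOmega_eq_gammaProd, gammaProd, gammaProd, zero_sub,
    show 1 - (γ t + 1) = -γ t by ring, show β + N + 1 + 1 - (γ t + 1) = β + N + 1 - γ t by ring,
    ← add_assoc, ← add_assoc, Complex.Gamma_add_one _ h0, Complex.Gamma_add_one _ h1]
  ring

/-- Absolute convergence identifies the integral with the limit of symmetric truncations, the form
in which contour shifts are available. -/
theorem integral_eq_of_shift (hγ : IsSeparatingContour α β N γ) {p : ℂ[X]} {v : ℂ} {F : ℂ → ℂ}
    (hF : ∀ t, F (γ t + 1) - F (γ t) = p.eval (γ t) * hahnOmega α β N (γ t))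
    (h : Tendsto (fun T : ℝ => ∫ t in (-T)..T, (F (γ t + 1) - F (γ t)) * deriv γ t) atTop (𝓝 v)) :
    ∫ t, p.eval (γ t) * hahnOmega α β N (γ t) * deriv γ t = v := by
  simp only [hF] at h
  exact tendsto_nhds_unique (intervalIntegral_tendsto_integral (hγ.integrable p)
    tendsto_neg_atTop_atBot tendsto_id) h

end IsSeparatingContour

/-- The functional `p ↦ ∫_γ p(z) ω(z) dz`. -/
def contourFunctional {α β : ℂ} {N : ℕ} {γ : ℝ → ℂ} (hγ : IsSeparatingContour α β N γ) :
    ℂ[X] →ₗ[ℂ] ℂ where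
  toFun p := ∫ t, p.eval (γ t) * hahnOmega α β N (γ t) * deriv γ t
  map_add' p q := by
    rw [← integral_add (hγ.integrable p) (hγ.integrable q)]
    exact integral_congr_ae (Eventually.of_forall fun t => by simp only [eval_add]; ring)
  map_smul' c p := by
    rw [RingHom.id_apply, smul_eq_mul, ← integral_const_mul]
    exact integral_congr_ae (Eventually.of_forall fun t => by
      simp only [eval_smul, smul_eq_mul]; ring)

theorem contourFunctional_apply {α β : ℂ} {N : ℕ} {γ : ℝ → ℂ} (hγ : IsSeparatingContour α β N γ)
    (p : ℂ[X]) : contourFunctional hγ p =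
      ∫ t, p.eval (γ t) * hahnOmega α β N (γ t) * deriv γ t := rfl

/-- Shift the contour for `F = p W`: no pole of `F` changes side, so the integral of `F(z+1) - F(z)`
is `0`. -/
theorem isPearson_contourFunctional {α β : ℂ} {N : ℕ} {γ : ℝ → ℂ}
    (hγ : IsSeparatingContour α β N γ) :
    IsPearson (contourFunctional hγ) (α + N + 2) 1 (β + N + 1) := by
  intro p
  obtain ⟨R, hR⟩ := hγ.exists_re_lt
  obtain ⟨m, ha, hb, hc, hd⟩ := exists_nat_shift_re R 1 (α + N + 2) 1 (β + N + 1 + 1)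
  have hF : ∀ z, p.eval z * gammaProd 1 (α + N + 2) 1 (β + N + 1 + 1) z =
      p.eval z * gammaProd (1 + m) (α + N + 2 + m) (1 + m) (β + N + 1 + 1 + m) z /
        (gammaDenom 1 (α + N + 2) 1 (β + N + 1 + 1) m).eval z := fun z => by
    rw [gammaProd_eq_div _ _ _ _ m, mul_div_assoc]
  rw [contourFunctional_apply]
  refine hγ.integral_eq_of_shift
    (F := fun z => p.eval z * gammaProd 1 (α + N + 2) 1 (β + N + 1 + 1) z) (fun t => ?_) ?_
  · rw [hγ.gammaProd_eq, hγ.gammaProd_add_one_eq]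
    simp only [eval_sub, eval_mul, taylor_eval, eval_add, eval_X, eval_C]
    ring
  · have hlim := tendsto_eval_mul_gammaProd R 1 (α + N + 2) 1 (β + N + 1 + 1) p
    simp only [hF] at hlim ⊢
    exact tendsto_shift_of_sameSide hγ.toIsVerticalContour hR _
      (fun z => p.eval z * gammaProd (1 + m) (α + N + 2 + m) (1 + m) (β + N + 1 + 1 + m) z)
      (gammaDenom 1 (α + N + 2) 1 (β + N + 1 + 1) m) rfl (gammaDenom_ne_zero _ _ _ _ m)
      (p.differentiable.differentiableOn.mul (differentiableOn_gammaProd ha hb hc hd))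
      (fun _ hq => hγ.sameSide_root hq) hlim

/-- For `F = W(z) / z` the difference `F(z+1) - F(z)` is `(α+β+2N+3) ω(z)`. The only pole that
changes side is the simple one at `0`, with nonzero residue, so `(α+β+2N+3) L 1` is a nonzero
multiple of `2πi`. -/
theorem contourFunctional_one_ne_zero {α β : ℂ} {N : ℕ} {γ : ℝ → ℂ}
    (hγ : IsSeparatingContour α β N γ) : contourFunctional hγ 1 ≠ 0 := by
  obtain ⟨R, hR⟩ := hγ.exists_re_lt
  have hR0 : 0 < R := by linarith [hR 0, abs_nonneg (γ 0).re]
  obtain ⟨m, ha, hb, hc, hd⟩ := exists_nat_shift_re R 1 (α + N + 2) 1 (β + N + 1 + 1)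
  obtain ⟨P, hP⟩ : ∃ P, P = gammaDenom 1 (α + N + 2) 1 (β + N + 1 + 1) m := ⟨_, rfl⟩
  obtain ⟨H, hH⟩ : ∃ H, H = gammaProd (1 + m) (α + N + 2 + m) (1 + m) (β + N + 1 + 1 + m) :=
    ⟨_, rfl⟩
  have hF : ∀ z, gammaProd 1 (α + N + 2) 1 (β + N + 1 + 1) z * (z - 0)⁻¹ =
      H z / ((X - C 0) * P).eval z := fun z => by
    rw [gammaProd_eq_div _ _ _ _ m, ← hP, ← hH, eval_mul, eval_sub, eval_X, eval_C,
      mul_comm (z - 0), ← div_div, div_eq_mul_inv _ (z - 0)]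
  have hlim : Tendsto (fun z => H z / ((X - C 0) * P).eval z) (vEnds R) (𝓝 0) := by
    simp only [← hF]
    simpa using (tendsto_eval_mul_gammaProd R 1 (α + N + 2) 1 (β + N + 1 + 1) 1).mul
      (tendsto_inv_sub_vEnds R 0)
  have hleft : IsLeftOf γ (0 - 1) := by
    have := hγ.left₁ 0
    convert this using 1; simp
  obtain ⟨hP0, hmain⟩ := tendsto_shift_of_simple_pole hγ.toIsVerticalContour hR (H := H) (P := P)
    (p := 0) (hP ▸ gammaDenom_ne_zero _ _ _ _ m) (hH ▸ differentiableOn_gammaProd ha hb hc hd)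
    (fun q hq => hγ.sameSide_root (hP ▸ hq)) (by simpa using hγ.right₁ 0) hleft hlim
  simp only [← hF] at hmain
  have hval := hγ.integral_eq_of_shift (p := C (α + β + 2 * N + 3))
    (F := fun z => gammaProd 1 (α + N + 2) 1 (β + N + 1 + 1) z * (z - 0)⁻¹) (fun t => ?_) hmain
  · rw [← contourFunctional_apply hγ, ← mul_one (C _), map_C_mul] at hval
    intro h0
    rw [h0, mul_zero] at hval
    have hH0 : H 0 ≠ 0 := hH ▸ gammaProd_ne_zero_of_re_pos (hR0.trans ha) (hR0.trans hb)
      (hR0.trans hc) (hR0.trans hd)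
    exact mul_ne_zero (div_ne_zero hH0 hP0) Complex.two_pi_I_ne_zero hval.symm
  · have h0 : γ t ≠ 0 := by simpa using (hγ.right₁ 0).1 t
    have h1 : γ t + 1 ≠ 0 := fun h => (hγ.left₁ 0).1 t (by push_cast; linear_combination h)
    simp only [hγ.gammaProd_eq, hγ.gammaProd_add_one_eq, sub_zero, eval_C]
    field_simp
    ring

/-! ### Orthogonal sequences for symmetric bilinear forms -/

theorem exists_eq_C_mul_add {q : ℕ → ℂ[X]} (hm : ∀ n, (q n).Monic) (hd : ∀ n, (q n).natDegree = n)
    {n : ℕ} {g : ℂ[X]} (hg : g.degree < (n + 1 : ℕ)) :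
    ∃ s : ℂ[X], s.degree < n ∧ g = C (g.coeff n) * q n + s := by
  refine ⟨g - C (g.coeff n) * q n, ?_, by ring⟩
  rw [degree_lt_iff_coeff_zero]
  intro k hk
  rw [coeff_sub, coeff_C_mul]
  rcases hk.eq_or_lt with rfl | hk
  · have h1 : (q n).coeff n = 1 := by
      have := (hm n).coeff_natDegree
      rwa [hd] at this
    rw [h1, mul_one, sub_self]
  · rw [coeff_eq_zero_of_natDegree_lt (p := q n) (by rw [hd]; exact hk), mul_zero, sub_zero]
    exact (degree_lt_iff_coeff_zero _ _).1 hg k hk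

theorem eq_zero_of_forall_monic_seq {q : ℕ → ℂ[X]} (hm : ∀ n, (q n).Monic)
    (hd : ∀ n, (q n).natDegree = n) (f : ℂ[X] →ₗ[ℂ] ℂ) (n : ℕ) (hf : ∀ m < n, f (q m) = 0) :
    ∀ g : ℂ[X], g.degree < n → f g = 0 := by
  induction n with
  | zero =>
    intro g hg
    have : g = 0 := by simpa using hg
    rw [this, map_zero]
  | succ n ih =>
    intro g hg
    obtain ⟨s, hs, h⟩ := exists_eq_C_mul_add hm hd hg
    rw [h, map_add, map_C_mul, hf n n.lt_succ_self, ih (fun m hm => hf m (hm.trans n.lt_succ_self)) s hs,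
      mul_zero, add_zero]

theorem degree_eq_of_monic {p : ℂ[X]} {n : ℕ} (hm : p.Monic) (hd : p.natDegree = n) :
    p.degree = n := by
  rw [degree_eq_natDegree hm.ne_zero, hd]

/-- A monic sequence orthogonal to all polynomials of lower degree, with nonvanishing norms, is
the unique monic orthogonal polynomial sequence of the bilinear form. -/
theorem mops_characterization (B : ℂ[X] →ₗ[ℂ] ℂ[X] →ₗ[ℂ] ℂ) (hsymm : ∀ f g, B f g = B g f)
    {P : ℕ → ℂ[X]} (hm : ∀ n, (P n).Monic) (hd : ∀ n, (P n).natDegree = n)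
    (horth : ∀ (n : ℕ) (g : ℂ[X]), g.degree < n → B (P n) g = 0) (hnorm : ∀ n, B (P n) (P n) ≠ 0) :
    IsMOPS (fun f g => B f g) P ∧
      (∀ (n : ℕ) (q : ℂ[X]), q = P n ↔ q.Monic ∧ q.natDegree = n ∧ ∀ m < n, B q (X ^ m) = 0) ∧
      ∀ q : ℕ → ℂ[X], IsMOPS (fun f g => B f g) q ↔ q = P := by
  have hdeg : ∀ n, (P n).degree = n := fun n => degree_eq_of_monic (hm n) (hd n)
  have hmops : IsMOPS (fun f g => B f g) P := by
    refine ⟨hm, hd, fun m n hmn => ?_, hnorm⟩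
    rcases lt_or_gt_of_ne hmn with h | h
    · rw [hsymm]
      exact horth n _ (by rw [hdeg]; exact_mod_cast h)
    · exact horth m _ (by rw [hdeg]; exact_mod_cast h)
  have huniq : ∀ (n : ℕ) (q : ℂ[X]), q.Monic → q.natDegree = n → (∀ g : ℂ[X], g.degree < n → B q g = 0) →
      q = P n := by
    intro n q hqm hqd hq
    by_contra hne
    have hr0 : q - P n ≠ 0 := sub_ne_zero.2 hne
    have hrlt : (q - P n).degree < n := by
      have h1 := degree_eq_of_monic hqm hqd
      rw [← h1]
      refine degree_sub_lt_left (by rw [h1, hdeg]) hqm.ne_zero ?_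
      rw [hqm.leadingCoeff, (hm n).leadingCoeff]
    obtain ⟨m, hmr⟩ : ∃ m, (q - P n).natDegree = m := ⟨_, rfl⟩
    have hrm : (q - P n).degree = m := by rw [degree_eq_natDegree hr0, hmr]
    have hmn : m < n := by rw [hrm] at hrlt; exact_mod_cast hrlt
    obtain ⟨s, hs, h⟩ := exists_eq_C_mul_add hm hd (n := m) (g := q - P n)
      (by rw [hrm]; exact_mod_cast m.lt_succ_self)
    have hPm : (P m).degree < n := by rw [hdeg]; exact_mod_cast hmn
    -- Here `m` is the degree of `q - P n`. Pairing with `P m` isolates its leading coefficient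
    -- times the norm of `P m`, a contradiction.
    have h1 : B (P m) (q - P n) = 0 := by
      rw [hsymm, map_sub, LinearMap.sub_apply, hq _ hPm, horth n _ hPm, sub_zero]
    rw [h, map_add, map_C_mul, horth m s hs, add_zero] at h1
    refine mul_ne_zero ?_ (hnorm m) h1
    rw [← hmr]
    exact leadingCoeff_ne_zero.2 hr0
  refine ⟨hmops, fun n q => ⟨?_, fun h => ?_⟩, fun q => ⟨fun h => ?_, ?_⟩⟩
  · rintro rfl
    exact ⟨hm n, hd n, fun m hmn => horth n _ (by rw [degree_X_pow]; exact_mod_cast hmn)⟩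
  · exact huniq n q h.1 h.2.1 (eq_zero_of_forall_monic_seq (q := fun m => X ^ m)
      (fun m => monic_X_pow m) (fun m => natDegree_X_pow m) (B q) n h.2.2)
  · funext n
    exact huniq n _ (h.monic n) (h.natDegree_eq n) (eq_zero_of_forall_monic_seq h.monic
      h.natDegree_eq (B (q n)) n fun m hmn => h.orthogonal n m hmn.ne')
  · rintro rfl
    exact hmops

/-! ### The discrete part of the inner product -/

/-- The functional `p ↦ ∑_{x=0}^N p(x) ρ(x)`. -/
def discreteFunctional (α β : ℂ) (N : ℕ) : ℂ[X] →ₗ[ℂ] ℂ where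
  toFun p := ∑ x ∈ Finset.range (N + 1), p.eval (x : ℂ) * hahnRho α β N x
  map_add' p q := by
    rw [← Finset.sum_add_distrib]
    exact Finset.sum_congr rfl fun x _ => by rw [eval_add]; ring
  map_smul' c p := by
    rw [RingHom.id_apply, smul_eq_mul, Finset.mul_sum]
    exact Finset.sum_congr rfl fun x _ => by rw [eval_smul, smul_eq_mul]; ring

theorem discreteFunctional_apply (α β : ℂ) (N : ℕ) (p : ℂ[X]) :
    discreteFunctional α β N p =
      ∑ x ∈ Finset.range (N + 1), p.eval (x : ℂ) * hahnRho α β N x := rfl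

/-- The replacement `(a+1)_x` obeys the same recurrence as `Γ(a+x+1)`, so the exceptional parameter
needs no separate treatment later. -/
theorem weightGamma_succ {N : ℕ} {a : ℂ} (ha : ∀ j : ℕ, 1 ≤ j → j ≠ N + 1 → -a ≠ (j : ℂ)) {x : ℕ}
    (hx : x < N) : weightGamma N a (x + 1) = (a + x + 1) * weightGamma N a x := by
  unfold weightGamma
  split_ifs with h
  · rw [poch_succ]; ring
  · have h0 : a + x + 1 ≠ 0 := fun h0 =>
      ha (x + 1) (by omega) (by omega) (by push_cast; linear_combination -h0)
    push_cast
    rw [← add_assoc, Complex.Gamma_add_one _ h0]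

theorem weightGamma_ne_zero {N : ℕ} {a : ℂ} (ha : ∀ j : ℕ, 1 ≤ j → j ≠ N + 1 → -a ≠ (j : ℂ))
    {x : ℕ} (hx : x ≤ N) : weightGamma N a x ≠ 0 := by
  unfold weightGamma
  split_ifs with h
  · rw [Ne, poch_eq_zero_iff]
    rintro ⟨k, hk, hk'⟩
    have : (N : ℂ) = k := by rw [h] at hk'; linear_combination -hk'
    have : N = k := by exact_mod_cast this
    omega
  · refine Complex.Gamma_ne_zero fun m hm => ?_
    by_cases hj : x + 1 + m = N + 1
    · apply h
      have : (x : ℂ) + 1 + m = N + 1 := by exact_mod_cast hj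
      linear_combination hm - this
    · exact ha (x + 1 + m) (by omega) hj (by push_cast; linear_combination -hm)

theorem hahnRho_succ {N : ℕ} {α β : ℂ}
    (hα : ∀ j : ℕ, 1 ≤ j → j ≠ N + 1 → -α ≠ (j : ℂ))
    (hβ : ∀ j : ℕ, 1 ≤ j → j ≠ N + 1 → -β ≠ (j : ℂ)) {x : ℕ} (hx : x < N) :
    (x + 1) * (β + N - x) * hahnRho α β N (x + 1) = (α + x + 1) * (N - x) * hahnRho α β N x := by
  obtain ⟨y, rfl⟩ := Nat.exists_eq_add_of_lt hx
  have h1 : (y : ℂ) + 1 ≠ 0 := by exact_mod_cast y.succ_ne_zero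
  have h2 : (x : ℂ) + 1 ≠ 0 := by exact_mod_cast x.succ_ne_zero
  have g1 : Complex.Gamma ((y : ℂ) + 1) ≠ 0 := by
    rw [Complex.Gamma_nat_eq_factorial]; exact_mod_cast y.factorial_ne_zero
  have g2 : Complex.Gamma ((x : ℂ) + 1) ≠ 0 := by
    rw [Complex.Gamma_nat_eq_factorial]; exact_mod_cast x.factorial_ne_zero
  rw [hahnRho, hahnRho, show x + y + 1 - (x + 1) = y by omega, show x + y + 1 - x = y + 1 by omega,
    weightGamma_succ hα hx, weightGamma_succ hβ (show y < x + y + 1 by omega)]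
  push_cast
  rw [show (x : ℂ) + y + 1 + 1 - (x + 1) = y + 1 by ring, show (x : ℂ) + y + 1 + 1 - x = y + 1 + 1 by ring,
    Complex.Gamma_add_one _ h1, Complex.Gamma_add_one _ h2]
  field_simp
  ring

/-- The sum telescopes: the factor `x - N` removes the top term of the shifted sum and the factor
`x` the bottom term of the other. -/
theorem isPearson_discreteFunctional {N : ℕ} {α β : ℂ}
    (hα : ∀ j : ℕ, 1 ≤ j → j ≠ N + 1 → -α ≠ (j : ℂ))
    (hβ : ∀ j : ℕ, 1 ≤ j → j ≠ N + 1 → -β ≠ (j : ℂ)) :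
    IsPearson (discreteFunctional α β N) (α + 1) (-(N : ℂ)) (β + N + 1) := by
  intro p
  rw [map_sub, discreteFunctional_apply, discreteFunctional_apply, Finset.sum_range_succ,
    Finset.sum_range_succ']
  simp only [eval_mul, eval_add, eval_sub, eval_X, eval_C, taylor_eval, add_neg_cancel, mul_zero,
    zero_mul, add_zero, Nat.cast_zero]
  rw [← Finset.sum_sub_distrib]
  refine Finset.sum_eq_zero fun x hx => ?_
  have h := hahnRho_succ hα hβ (Finset.mem_range.1 hx)
  push_cast
  linear_combination p.eval (x + 1 : ℂ) * h

/-- At a mass point `x ≥ 1` the factor `x - N + j` with `j = N - x < N` vanishes, so the sum reduces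
to its term at `x = 0`. -/
theorem discreteFunctional_pearsonWeight_ne_zero {N : ℕ} {α β : ℂ}
    (hα : ∀ j : ℕ, 1 ≤ j → j ≠ N + 1 → -α ≠ (j : ℂ))
    (hβ : ∀ j : ℕ, 1 ≤ j → j ≠ N + 1 → -β ≠ (j : ℂ)) :
    discreteFunctional α β N (pearsonWeight (α + 1) (-(N : ℂ)) N) ≠ 0 := by
  have heval : ∀ x : ℂ, (pearsonWeight (α + 1) (-(N : ℂ)) N).eval x =
      ∏ j ∈ Finset.range N, (x + (α + 1 + j)) * (x + (-N + j)) := fun x => by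
    simp [pearsonWeight, eval_prod]
  rw [discreteFunctional_apply, Finset.sum_eq_single_of_mem 0 (by simp)]
  · refine mul_ne_zero ?_ ?_
    · rw [heval, Finset.prod_ne_zero_iff]
      intro j hj
      have hj' := Finset.mem_range.1 hj
      refine mul_ne_zero (fun h => ?_) (fun h => ?_)
      · exact hα (j + 1) (by omega) (by omega) (by push_cast at h ⊢; linear_combination -h)
      · have : (j : ℂ) = N := by push_cast at h; linear_combination h
        have : j = N := by exact_mod_cast this
        omega
    · refine div_ne_zero (mul_ne_zero (weightGamma_ne_zero hβ (by omega))
        (weightGamma_ne_zero hα (by omega))) ?_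
      simp only [Nat.cast_zero, sub_zero, zero_add, Complex.Gamma_one, mul_one,
        Complex.Gamma_nat_eq_factorial]
      exact_mod_cast N.factorial_ne_zero
  · intro x hx hx0
    have hx' := Finset.mem_range.1 hx
    rw [heval, Finset.prod_eq_zero (i := N - x) (Finset.mem_range.2 (by omega)), zero_mul]
    rw [Nat.cast_sub (by omega)]
    ring

/-- Terms with `k ≤ N` contain `(-N+k)_{n-k} = 0`, terms with `k > N` contain `(-x)_k = 0`. -/
theorem eval_hahnPoly_eq_zero {α β : ℂ} {N n x : ℕ} (hn : N < n) (hx : x ≤ N) :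
    (hahnPoly α β N n).eval (x : ℂ) = 0 := by
  rw [hahnPoly_eq_hahnGen, hahnGen, eval_finsetSum]
  refine Finset.sum_eq_zero fun k hk => ?_
  rw [eval_mul, eval_C]
  rcases le_or_gt k N with hk' | hk'
  · have : poch (-(N : ℂ) + k) (n - k) = 0 :=
      (poch_eq_zero_iff _ _).2 ⟨N - k, by omega, by rw [Nat.cast_sub hk']; ring⟩
    rw [hahnCoeff, this]
    simp
  · rw [eval_negPoch_eq_zero (hx.trans_lt hk'), mul_zero]

/-! ### The Sobolev form -/

theorem deltaIter_eq_eval (m : ℕ) (f : ℂ[X]) (z : ℂ) :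
    deltaIter m f z = ((polyDiff^[m]) f).eval z := by
  induction m generalizing f z with
  | zero => rfl
  | succ m ih =>
    have h : deltaIter (m + 1) f = deltaIter m (polyDiff f) := by
      rw [deltaIter, deltaIter, Function.iterate_succ_apply]
      congr 1
      funext z
      simp [fwdDiff, polyDiff_apply, taylor_eval]
    rw [h, ih, Function.iterate_succ_apply]

theorem degree_iterate_polyDiff_lt {g : ℂ[X]} (n m : ℕ) (h : g.degree < (n + m : ℕ)) :
    ((polyDiff^[m]) g).degree < n := by
  induction m generalizing g with
  | zero => simpa using h
  | succ m ih => exact ih (natDegree_polyDiff_lt _ h)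

/-- The Sobolev form as a bilinear map. -/
def sobolevBilin {α β : ℂ} {N : ℕ} {γ : ℝ → ℂ} (hγ : IsSeparatingContour α β N γ) :
    ℂ[X] →ₗ[ℂ] ℂ[X] →ₗ[ℂ] ℂ :=
  (LinearMap.mul ℂ ℂ[X]).compr₂ (discreteFunctional α β N) +
    ((LinearMap.mul ℂ ℂ[X]).compl₁₂ (polyDiff ^ (N + 1)) (polyDiff ^ (N + 1))).compr₂
      (contourFunctional hγ)

theorem sobolevBilin_apply {α β : ℂ} {N : ℕ} {γ : ℝ → ℂ} (hγ : IsSeparatingContour α β N γ)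
    (f g : ℂ[X]) : sobolevBilin hγ f g = discreteFunctional α β N (f * g) +
      contourFunctional hγ ((polyDiff^[N + 1]) f * (polyDiff^[N + 1]) g) := by
  simp [sobolevBilin, Module.End.pow_apply]

theorem sobolevIntegrand_eq (α β : ℂ) (N : ℕ) (γ : ℝ → ℂ) (f g : ℂ[X]) :
    sobolevIntegrand α β N γ f g = fun t => ((polyDiff^[N + 1]) f * (polyDiff^[N + 1]) g).eval (γ t) *
      hahnOmega α β N (γ t) * deriv γ t := by
  funext t
  rw [sobolevIntegrand, deltaIter_eq_eval, deltaIter_eq_eval, eval_mul]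

theorem sobolevForm_eq {α β : ℂ} {N : ℕ} {γ : ℝ → ℂ} (hγ : IsSeparatingContour α β N γ) :
    sobolevForm α β N γ = fun f g => sobolevBilin hγ f g := by
  funext f g
  rw [sobolevBilin_apply, sobolevForm, sobolevIntegrand_eq, discreteFunctional_apply,
    contourFunctional_apply]
  simp only [eval_mul]

theorem sobolevBilin_hahnPoly {α β : ℂ} {N : ℕ} {γ : ℝ → ℂ} (hγ : IsSeparatingContour α β N γ)
    (hα : ∀ j : ℕ, 1 ≤ j → j ≠ N + 1 → -α ≠ (j : ℂ))
    (hβ : ∀ j : ℕ, 1 ≤ j → j ≠ N + 1 → -β ≠ (j : ℂ))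
    (hαβ : ∀ j : ℕ, 1 ≤ j → j ≠ 2 * N + 2 → -α - β ≠ (j : ℂ)) (n : ℕ) :
    (∀ g : ℂ[X], g.degree < (n : ℕ) → sobolevBilin hγ (hahnPoly α β N n) g = 0) ∧
      sobolevBilin hγ (hahnPoly α β N n) (hahnPoly α β N n) ≠ 0 := by
  simp only [sobolevBilin_apply]
  rcases le_or_gt n N with hn | hn
  · have hL := isPearson_discreteFunctional hα hβ
    have hs : α + β + 2 = α + 1 + -(N : ℂ) + (β + N + 1) := by ring
    have hσ : ∀ k < n, α + β + 2 + (n : ℂ) - 1 + k ≠ 0 := fun k hk h =>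
      hαβ (n + 1 + k) (by omega) (by omega) (by push_cast; linear_combination -h)
    have h0 : (polyDiff^[N + 1]) (hahnPoly α β N n) = 0 := by
      refine iterate_polyDiff_eq_zero _ ?_
      rw [hahnPoly_eq_hahnGen, degree_eq_of_monic (hahnGen_monic _ _ _ _).1 (hahnGen_monic _ _ _ _).2]
      exact_mod_cast Nat.lt_succ_of_le hn
    simp only [h0, zero_mul, map_zero, add_zero]
    rw [hahnPoly_eq_hahnGen]
    refine ⟨fun g hg => hL.orthogonal n hs hσ g hg, hL.norm_ne_zero n hs hσ ?_⟩
    clear hσ h0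
    -- Downward induction from `n = N`: a vanishing mass at `n` forces a vanishing mass at `n + 1`,
    -- because `σ + 2n` and `σ + 2n + 1` are nonzero for `n < N`.
    induction hm : N - n generalizing n with
    | zero =>
      obtain rfl : n = N := by omega
      exact discreteFunctional_pearsonWeight_ne_zero hα hβ
    | succ m ih =>
      intro h1
      have h2 := hL.map_pearsonWeight_succ n hs
      rw [h1, mul_zero] at h2
      refine mul_ne_zero (mul_ne_zero (fun h => ?_) (fun h => ?_))
        (ih (n + 1) (by omega) (by omega)) h2
      · exact hαβ (2 * n + 2) (by omega) (by omega) (by push_cast; linear_combination -h)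
      · exact hαβ (2 * n + 3) (by omega) (by omega) (by push_cast; linear_combination -h)
  · obtain ⟨l, rfl⟩ : ∃ l, n = l + (N + 1) := ⟨n - (N + 1), by omega⟩
    have hd : ∀ g, discreteFunctional α β N (hahnPoly α β N (l + (N + 1)) * g) = 0 := fun g => by
      rw [discreteFunctional_apply]
      refine Finset.sum_eq_zero fun x hx => ?_
      rw [eval_mul, eval_hahnPoly_eq_zero hn (Nat.lt_succ_iff.1 (Finset.mem_range.1 hx)), zero_mul,
        zero_mul]
    have hL := isPearson_contourFunctional hγ
    obtain ⟨c, hc, h⟩ := iterate_polyDiff_hahnGen (N + 1) (α + 1) (-(N : ℂ)) (α + β + 2) l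
    rw [show α + 1 + ((N + 1 : ℕ) : ℂ) = α + N + 2 by push_cast; ring,
      show -(N : ℂ) + ((N + 1 : ℕ) : ℂ) = 1 by push_cast; ring,
      show α + β + 2 + 2 * ((N + 1 : ℕ) : ℂ) = α + β + 2 * N + 4 by push_cast; ring,
      ← hahnPoly_eq_hahnGen] at h
    have hs : α + β + 2 * N + 4 = α + N + 2 + 1 + (β + N + 1) := by ring
    have hσ : ∀ k < l, α + β + 2 * N + 4 + (l : ℂ) - 1 + k ≠ 0 := fun k hk h =>
      hαβ (2 * N + 3 + l + k) (by omega) (by omega) (by push_cast; linear_combination -h)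
    simp only [hd, zero_add, h]
    refine ⟨fun g hg => ?_, ?_⟩
    · rw [mul_assoc, map_C_mul, hL.orthogonal l hs hσ _ (degree_iterate_polyDiff_lt _ _ hg), mul_zero]
    · rw [mul_mul_mul_comm, ← C_mul, map_C_mul]
      refine mul_ne_zero (mul_ne_zero hc hc) (hL.norm_ne_zero l hs hσ ?_)
      clear hσ hn hd h
      -- Upward induction from `L 1 ≠ 0`: now the four factors on the right of the mass recurrence
      -- must be nonzero.
      induction l with
      | zero => simpa [pearsonWeight] using contourFunctional_one_ne_zero hγ
      | succ l ih =>
        intro h0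
        have h1 := hL.map_pearsonWeight_succ l hs
        rw [h0, mul_zero] at h1
        refine mul_ne_zero (mul_ne_zero (mul_ne_zero (mul_ne_zero (fun h => ?_) (fun h => ?_))
          (fun h => ?_)) (fun h => ?_)) ih h1.symm
        · exact hα (N + 2 + l) (by omega) (by omega) (by push_cast; linear_combination -h)
        · have : (1 : ℂ) + l ≠ 0 := by rw [add_comm]; exact_mod_cast l.succ_ne_zero
          exact this h
        · exact hαβ (2 * N + 3 + l) (by omega) (by omega) (by push_cast; linear_combination -h)
        · exact hβ (N + 2 + l) (by omega) (by omega) (by push_cast; linear_combination -h)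

theorem sobolevBilin_symm {α β : ℂ} {N : ℕ} {γ : ℝ → ℂ} (hγ : IsSeparatingContour α β N γ)
    (f g : ℂ[X]) : sobolevBilin hγ f g = sobolevBilin hγ g f := by
  rw [sobolevBilin_apply, sobolevBilin_apply, mul_comm f, mul_comm ((polyDiff^[N + 1]) f)]

/-! ### Existence of separating contours -/

/-- The contour `γ` avoids `p`, and the principal value of `(2πi)⁻¹ ∫_γ dz / (z - p)` is `v`. -/
def HasPV (γ : ℝ → ℂ) (p v : ℂ) : Prop :=
  (∀ t, γ t ≠ p) ∧
    Tendsto (fun T : ℝ => (2 * Real.pi * Complex.I)⁻¹ * ∫ t in (-T)..T, deriv γ t / (γ t - p))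
      atTop (𝓝 v)

/-- Dividing both arguments by `T > 0` cancels `log T`, and what remains tends to `log i - log
(-i)`. -/
theorem tendsto_log_add_sub_log_sub {x : ℂ} (hx : 0 < x.re) :
    Tendsto (fun T : ℝ => Complex.log (x + T * Complex.I) - Complex.log (x - T * Complex.I))
      atTop (𝓝 (Real.pi * Complex.I)) := by
  have h0 : Tendsto (fun T : ℝ => x / (T : ℂ)) atTop (𝓝 0) := by
    simp only [div_eq_mul_inv, ← Complex.ofReal_inv]
    simpa using ((Complex.continuous_ofReal.tendsto _).comp tendsto_inv_atTop_zero).const_mul x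
  have hI : Complex.I ∈ Complex.slitPlane := by simp [Complex.slitPlane]
  have hI' : -Complex.I ∈ Complex.slitPlane := by simp [Complex.slitPlane]
  have h1 : Tendsto (fun T : ℝ => Complex.log (x / T + Complex.I)) atTop (𝓝 (Complex.log Complex.I)) := by
    refine (continuousAt_clog hI).tendsto.comp ?_
    simpa using h0.add_const Complex.I
  have h2 : Tendsto (fun T : ℝ => Complex.log (x / T + -Complex.I)) atTop
      (𝓝 (Complex.log (-Complex.I))) := by
    refine (continuousAt_clog hI').tendsto.comp ?_
    simpa using h0.add_const (-Complex.I)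
  have h3 := h1.sub h2
  rw [Complex.log_I, Complex.log_neg_I] at h3
  have e : (Real.pi : ℂ) / 2 * Complex.I - -(Real.pi / 2) * Complex.I = Real.pi * Complex.I := by ring
  rw [e] at h3
  refine h3.congr' ?_
  filter_upwards [eventually_gt_atTop 0] with T hT
  have hTc : (T : ℂ) ≠ 0 := by exact_mod_cast hT.ne'
  have key : ∀ y : ℂ, (x / T + y) ≠ 0 →
      Complex.log (x + T * y) = Real.log T + Complex.log (x / T + y) := fun y hy => by
    rw [← Complex.log_ofReal_mul hT hy, mul_add, mul_div_cancel₀ _ hTc]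
  have hne : ∀ y : ℂ, y.re = 0 → x / T + y ≠ 0 := fun y hy h => by
    have := congrArg Complex.re h
    rw [Complex.add_re, hy, Complex.div_ofReal_re, add_zero, Complex.zero_re] at this
    exact (div_pos hx hT).ne' this
  rw [key _ (hne _ Complex.I_re), sub_eq_add_neg x, ← mul_neg, key _ (hne _ (by simp))]
  ring

/-- The upward vertical line `Re z = c`. -/
def vLine (c : ℝ) (t : ℝ) : ℂ := c + t * Complex.I

theorem hasDerivAt_vLine (c t : ℝ) : HasDerivAt (vLine c) Complex.I t := by
  have h : HasDerivAt (fun x : ℝ => (x : ℂ) * Complex.I) Complex.I t := by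
    simpa using (Complex.ofRealCLM.hasDerivAt (x := t)).mul_const Complex.I
  exact h.const_add (c : ℂ)

theorem deriv_vLine (c : ℝ) : deriv (vLine c) = fun _ => Complex.I :=
  funext fun t => (hasDerivAt_vLine c t).deriv

theorem isVerticalContour_vLine (c : ℝ) : IsVerticalContour (vLine c) where
  continuous := continuous_iff_continuousAt.2 fun t => (hasDerivAt_vLine c t).continuousAt
  piecewise_C1 := ⟨∅, Set.finite_empty, fun t _ =>
    ⟨(hasDerivAt_vLine c t).differentiableAt, by rw [deriv_vLine]; exact continuousAt_const⟩⟩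
  velocity_bounded := ⟨1, fun t => by rw [deriv_vLine]; simp⟩
  vertical := ⟨‖(c : ℂ)‖, fun t => by simp [vLine]⟩

theorem vLine_ne {c : ℝ} {p : ℂ} (h : p.re ≠ c) (t : ℝ) : vLine c t ≠ p := fun ht => by
  apply h
  rw [← ht]
  simp [vLine]

theorem hasPV_vLine_left {c : ℝ} {p : ℂ} (h : p.re < c) : HasPV (vLine c) p (1 / 2) := by
  refine ⟨vLine_ne h.ne, ?_⟩
  have hx : 0 < (c - p : ℂ).re := by simpa using h
  have h1 := (tendsto_log_add_sub_log_sub hx).const_mul (2 * Real.pi * Complex.I)⁻¹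
  have hpi : (Real.pi : ℂ) ≠ 0 := by exact_mod_cast Real.pi_ne_zero
  have e : (2 * Real.pi * Complex.I)⁻¹ * (Real.pi * Complex.I) = (1 / 2 : ℂ) := by
    have := Complex.I_ne_zero
    field_simp
  rw [e] at h1
  refine h1.congr fun T => ?_
  congr 1
  rw [deriv_vLine]
  have hd : ∀ t : ℝ, HasDerivAt (fun t : ℝ => Complex.log (vLine c t - p))
      (Complex.I / (vLine c t - p)) t := fun t =>
    ((hasDerivAt_vLine c t).sub_const p).clog_real (Or.inl (by simpa [vLine] using h))
  rw [intervalIntegral.integral_eq_sub_of_hasDerivAt (fun t _ => hd t)]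
  · simp only [vLine]
    push_cast
    congr 2 <;> ring
  · refine Continuous.intervalIntegrable ?_ _ _
    exact continuous_const.div ((isVerticalContour_vLine c).continuous.sub continuous_const)
      fun t => sub_ne_zero.2 (vLine_ne h.ne t)

/-- The primitive is `log (p - z)` rather than `log (z - p)`, so that the argument stays in the
right half-plane. -/
theorem hasPV_vLine_right {c : ℝ} {p : ℂ} (h : c < p.re) : HasPV (vLine c) p (-1 / 2) := by
  refine ⟨vLine_ne h.ne', ?_⟩
  have hx : 0 < (p - c : ℂ).re := by simpa using h
  have h1 := (tendsto_log_add_sub_log_sub hx).neg.const_mul (2 * Real.pi * Complex.I)⁻¹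
  have hpi : (Real.pi : ℂ) ≠ 0 := by exact_mod_cast Real.pi_ne_zero
  have e : (2 * Real.pi * Complex.I)⁻¹ * -(Real.pi * Complex.I) = (-1 / 2 : ℂ) := by
    have := Complex.I_ne_zero
    field_simp
  rw [e] at h1
  refine h1.congr fun T => ?_
  congr 1
  rw [deriv_vLine]
  have hd : ∀ t : ℝ, HasDerivAt (fun t : ℝ => Complex.log (p - vLine c t))
      (Complex.I / (vLine c t - p)) t := fun t => by
    refine (((hasDerivAt_vLine c t).const_sub p).clog_real
      (Or.inl (by simpa [vLine] using h))).congr_deriv ?_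
    rw [← neg_sub, div_neg, neg_div, neg_neg]
  rw [intervalIntegral.integral_eq_sub_of_hasDerivAt (fun t _ => hd t)]
  · simp only [vLine]
    push_cast
    rw [neg_sub]
    congr 2 <;> ring
  · refine Continuous.intervalIntegrable ?_ _ _
    exact continuous_const.div ((isVerticalContour_vLine c).continuous.sub continuous_const)
      fun t => sub_ne_zero.2 (vLine_ne h.ne' t)

/-! ### Inserting a circle into a contour -/

/-- Truncation of `t` to `[-π, π]`. -/
def piClamp (t : ℝ) : ℝ := max (-Real.pi) (min t Real.pi)

theorem continuous_piClamp : Continuous piClamp :=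
  continuous_const.max (continuous_id.min continuous_const)

theorem piClamp_of_le {t : ℝ} (h : t ≤ -Real.pi) : piClamp t = -Real.pi := by
  have := Real.pi_pos
  rw [piClamp, min_eq_left (by linarith), max_eq_left h]

theorem piClamp_of_ge {t : ℝ} (h : Real.pi ≤ t) : piClamp t = Real.pi := by
  have := Real.pi_pos
  rw [piClamp, min_eq_right h, max_eq_right (by linarith)]

theorem piClamp_of_mem {t : ℝ} (h : -Real.pi ≤ t) (h' : t ≤ Real.pi) : piClamp t = t := by
  rw [piClamp, min_eq_left h', max_eq_right h]

theorem abs_piClamp_le (t : ℝ) : |piClamp t| ≤ Real.pi :=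
  abs_le.2 ⟨le_max_left _ _, max_le (by linarith [Real.pi_pos]) (min_le_right _ _)⟩

/-- Insertion into `γ`, at parameter `0`, of the circle with centre `γ 0 + a` through `γ 0`,
run through once with orientation `ε = ±1`. -/
def insertLoop (γ : ℝ → ℂ) (a : ℂ) (ε : ℝ) (t : ℝ) : ℂ :=
  γ (t - piClamp t) + a * (Complex.exp ((ε * piClamp t : ℝ) * Complex.I) + 1)

section insertLoop

variable {γ : ℝ → ℂ} {a : ℂ} {ε : ℝ}

theorem exp_sign_mul_pi (hε : ε = 1 ∨ ε = -1) (x : ℝ) (hx : x = Real.pi ∨ x = -Real.pi) :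
    Complex.exp ((ε * x : ℝ) * Complex.I) = -1 := by
  have h : ε * x = Real.pi ∨ ε * x = -Real.pi := by
    rcases hε with rfl | rfl <;> rcases hx with rfl | rfl <;> simp
  rcases h with h | h <;> rw [h]
  · exact Complex.exp_pi_mul_I
  · rw [Complex.ofReal_neg, neg_mul, Complex.exp_neg, Complex.exp_pi_mul_I]; norm_num

theorem insertLoop_of_le (hε : ε = 1 ∨ ε = -1) {t : ℝ} (h : t ≤ -Real.pi) :
    insertLoop γ a ε t = γ (t + Real.pi) := by
  rw [insertLoop, piClamp_of_le h, exp_sign_mul_pi hε _ (Or.inr rfl)]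
  simp

theorem insertLoop_of_ge (hε : ε = 1 ∨ ε = -1) {t : ℝ} (h : Real.pi ≤ t) :
    insertLoop γ a ε t = γ (t - Real.pi) := by
  rw [insertLoop, piClamp_of_ge h, exp_sign_mul_pi hε _ (Or.inl rfl)]
  simp

theorem insertLoop_of_mem {t : ℝ} (h : -Real.pi ≤ t) (h' : t ≤ Real.pi) :
    insertLoop γ a ε t = γ 0 + a * (Complex.exp ((ε * t : ℝ) * Complex.I) + 1) := by
  rw [insertLoop, piClamp_of_mem h h', sub_self]

/-- The inserted circle, based at `w`. -/
def loopCurve (w a : ℂ) (ε t : ℝ) : ℂ := w + a * (Complex.exp ((ε * t : ℝ) * Complex.I) + 1)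

theorem hasDerivAt_exp_mul_I (ε t : ℝ) :
    HasDerivAt (fun t : ℝ => Complex.exp ((ε * t : ℝ) * Complex.I))
      (ε * Complex.I * Complex.exp ((ε * t : ℝ) * Complex.I)) t := by
  have h : HasDerivAt (fun t : ℝ => ((ε * t : ℝ) : ℂ) * Complex.I) (ε * Complex.I) t := by
    have := (((hasDerivAt_id t).const_mul ε).ofReal_comp).mul_const Complex.I
    simpa using this
  refine h.cexp.congr_deriv ?_
  ring

theorem hasDerivAt_loopCurve (w a : ℂ) (ε t : ℝ) :
    HasDerivAt (loopCurve w a ε) (a * (ε * Complex.I * Complex.exp ((ε * t : ℝ) * Complex.I))) t :=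
  (((hasDerivAt_exp_mul_I ε t).add_const 1).const_mul a).const_add w

theorem continuous_exp_mul_I (ε : ℝ) :
    Continuous fun t : ℝ => Complex.exp ((ε * t : ℝ) * Complex.I) :=
  continuous_iff_continuousAt.2 fun t => (hasDerivAt_exp_mul_I ε t).continuousAt

theorem norm_exp_mul_I (x : ℝ) : ‖Complex.exp ((x : ℝ) * Complex.I)‖ = 1 :=
  Complex.norm_exp_ofReal_mul_I x

theorem insertLoop_eventuallyEq_lt (hε : ε = 1 ∨ ε = -1) {t : ℝ} (h : t < -Real.pi) :
    insertLoop γ a ε =ᶠ[𝓝 t] fun x => γ (x + Real.pi) := by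
  filter_upwards [Iio_mem_nhds h] with x hx
  exact insertLoop_of_le hε (le_of_lt hx)

theorem insertLoop_eventuallyEq_gt (hε : ε = 1 ∨ ε = -1) {t : ℝ} (h : Real.pi < t) :
    insertLoop γ a ε =ᶠ[𝓝 t] fun x => γ (x - Real.pi) := by
  filter_upwards [Ioi_mem_nhds h] with x hx
  exact insertLoop_of_ge hε (le_of_lt hx)

theorem insertLoop_eventuallyEq_mem {t : ℝ} (h : -Real.pi < t) (h' : t < Real.pi) :
    insertLoop γ a ε =ᶠ[𝓝 t] loopCurve (γ 0) a ε := by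
  filter_upwards [Ioo_mem_nhds h h'] with x hx
  exact insertLoop_of_mem hx.1.le hx.2.le

theorem deriv_insertLoop_lt (hε : ε = 1 ∨ ε = -1) {t : ℝ} (h : t < -Real.pi) :
    deriv (insertLoop γ a ε) t = deriv γ (t + Real.pi) := by
  rw [(insertLoop_eventuallyEq_lt hε h).deriv_eq, deriv_comp_add_const]

theorem deriv_insertLoop_gt (hε : ε = 1 ∨ ε = -1) {t : ℝ} (h : Real.pi < t) :
    deriv (insertLoop γ a ε) t = deriv γ (t - Real.pi) := by
  rw [(insertLoop_eventuallyEq_gt hε h).deriv_eq, deriv_comp_sub_const]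

theorem deriv_insertLoop_mem {t : ℝ} (h : -Real.pi < t) (h' : t < Real.pi) :
    deriv (insertLoop γ a ε) t = a * (ε * Complex.I * Complex.exp ((ε * t : ℝ) * Complex.I)) := by
  rw [(insertLoop_eventuallyEq_mem h h').deriv_eq, (hasDerivAt_loopCurve _ a ε t).deriv]

theorem isVerticalContour_insertLoop (hγ : IsVerticalContour γ) (a : ℂ) (hε : ε = 1 ∨ ε = -1) :
    IsVerticalContour (insertLoop γ a ε) where
  continuous := (hγ.continuous.comp (continuous_id.sub continuous_piClamp)).add
    (continuous_const.mul (((continuous_exp_mul_I ε).comp continuous_piClamp).add continuous_const))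
  piecewise_C1 := by
    obtain ⟨S, hS, hd⟩ := hγ.piecewise_C1
    refine ⟨(fun x => x - Real.pi) '' S ∪ (fun x => x + Real.pi) '' S ∪ {-Real.pi, Real.pi},
      ((hS.image _).union (hS.image _)).union (Set.toFinite _), fun t ht => ?_⟩
    simp only [Set.mem_union, Set.mem_image, Set.mem_insert_iff, Set.mem_singleton_iff,
      not_or, not_exists, not_and] at ht
    obtain ⟨⟨h1, h2⟩, h3, h4⟩ := ht
    rcases lt_or_gt_of_ne h3 with h | h
    · have e := insertLoop_eventuallyEq_lt (γ := γ) (a := a) hε h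
      have hS' : t + Real.pi ∉ S := fun hs => h1 _ hs (by ring)
      have hd' : deriv (fun x => γ (x + Real.pi)) = fun x => deriv γ (x + Real.pi) :=
        funext fun x => deriv_comp_add_const _ _ _
      refine ⟨(e.differentiableAt_iff).2 ((hd _ hS').1.hasDerivAt.comp_add_const t Real.pi).differentiableAt,
        (continuousAt_congr e.deriv).2 ?_⟩
      rw [hd']
      exact ContinuousAt.comp (f := fun x => x + Real.pi) (hd _ hS').2 (continuous_add_const _).continuousAt
    · rcases lt_or_gt_of_ne h4 with h' | h'
      · have e := insertLoop_eventuallyEq_mem (γ := γ) (a := a) (ε := ε) h h'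
        have hd' : deriv (loopCurve (γ 0) a ε) = fun t =>
            a * (ε * Complex.I * Complex.exp ((ε * t : ℝ) * Complex.I)) :=
          funext fun x => (hasDerivAt_loopCurve _ _ _ _).deriv
        refine ⟨(e.differentiableAt_iff).2 (hasDerivAt_loopCurve _ _ _ _).differentiableAt,
          (continuousAt_congr e.deriv).2 ?_⟩
        rw [hd']
        exact (continuous_const.mul (continuous_const.mul (continuous_exp_mul_I ε))).continuousAt
      · have e := insertLoop_eventuallyEq_gt (γ := γ) (a := a) hε h'
        have hS' : t - Real.pi ∉ S := fun hs => h2 _ hs (by ring)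
        have hd' : deriv (fun x => γ (x - Real.pi)) = fun x => deriv γ (x - Real.pi) :=
          funext fun x => deriv_comp_sub_const _ _ _
        refine ⟨(e.differentiableAt_iff).2 ((hd _ hS').1.hasDerivAt.comp_sub_const t Real.pi).differentiableAt,
          (continuousAt_congr e.deriv).2 ?_⟩
        rw [hd']
        exact ContinuousAt.comp (f := fun x => x - Real.pi) (hd _ hS').2
          (continuous_sub_right _).continuousAt
  velocity_bounded := by
    obtain ⟨M, hM⟩ := hγ.velocity_bounded
    -- The last two terms cover the junctions `t = ±π`, where the derivative is not computed.
    refine ⟨M + ‖a‖ + ‖deriv (insertLoop γ a ε) (-Real.pi)‖ + ‖deriv (insertLoop γ a ε) Real.pi‖,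
      fun t => ?_⟩
    have hM0 : 0 ≤ M := (norm_nonneg _).trans (hM 0)
    have n1 := norm_nonneg a
    have n2 := norm_nonneg (deriv (insertLoop γ a ε) (-Real.pi))
    have n3 := norm_nonneg (deriv (insertLoop γ a ε) Real.pi)
    rcases lt_trichotomy t (-Real.pi) with h | rfl | h
    · rw [deriv_insertLoop_lt hε h]
      linarith [hM (t + Real.pi)]
    · linarith
    rcases lt_trichotomy t Real.pi with h' | rfl | h'
    · rw [deriv_insertLoop_mem h h', norm_mul, norm_mul, norm_exp_mul_I, norm_mul, Complex.norm_I]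
      have : ‖(ε : ℂ)‖ = 1 := by rcases hε with rfl | rfl <;> simp
      rw [this]
      linarith
    · linarith
    · rw [deriv_insertLoop_gt hε h']
      linarith [hM (t - Real.pi)]
  vertical := by
    obtain ⟨M, hM⟩ := hγ.vertical
    refine ⟨M + Real.pi + ‖a‖ * 2, fun t => ?_⟩
    have e : insertLoop γ a ε t - t * Complex.I =
        (γ (t - piClamp t) - (t - piClamp t : ℝ) * Complex.I) + -(piClamp t * Complex.I) +
          a * (Complex.exp ((ε * piClamp t : ℝ) * Complex.I) + 1) := by
      rw [insertLoop]; push_cast; ring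
    rw [e]
    refine (norm_add₃_le).trans (add_le_add (add_le_add (hM _) ?_) ?_)
    · rw [norm_neg, norm_mul, Complex.norm_I, mul_one, Complex.norm_real]
      exact abs_piClamp_le t
    · rw [norm_mul]
      refine mul_le_mul_of_nonneg_left ((norm_add_le _ _).trans ?_) (norm_nonneg a)
      rw [norm_exp_mul_I, norm_one]
      norm_num

theorem one_add_mem_slitPlane {u : ℂ} (hu : ‖u‖ < 1) : 1 + u ∈ Complex.slitPlane := by
  refine Or.inl ?_
  have := Complex.abs_re_le_norm u
  have := (abs_le.1 this).1
  rw [Complex.add_re, Complex.one_re]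
  linarith

/-- The winding number of the inserted circle. -/
theorem integral_loopCurve (hε : ε = 1 ∨ ε = -1) {w p : ℂ} (h : ‖p - w - a‖ ≠ ‖a‖) :
    ∫ t in (-Real.pi)..Real.pi, a * (ε * Complex.I * Complex.exp ((ε * t : ℝ) * Complex.I)) /
        (loopCurve w a ε t - p) =
      2 * Real.pi * Complex.I * (if ‖p - w - a‖ < ‖a‖ then (ε : ℂ) else 0) := by
  have hE : ∀ t : ℝ, Complex.exp ((ε * t : ℝ) * Complex.I) ≠ 0 := fun t => Complex.exp_ne_zero _
  obtain ⟨q, hq⟩ : ∃ q, q = p - w - a := ⟨_, rfl⟩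
  have hcurve : ∀ t, loopCurve w a ε t - p = a * Complex.exp ((ε * t : ℝ) * Complex.I) - q :=
    fun t => by rw [loopCurve, hq]; ring
  rw [← hq] at h ⊢
  have hne : ∀ t : ℝ, a * Complex.exp ((ε * t : ℝ) * Complex.I) - q ≠ 0 := fun t ht => by
    apply h
    rw [← sub_eq_zero.1 ht, norm_mul, norm_exp_mul_I, mul_one]
  have hcont : Continuous fun t : ℝ => a * (ε * Complex.I * Complex.exp ((ε * t : ℝ) * Complex.I)) /
        (loopCurve w a ε t - p) := by
    simp only [hcurve]
    exact (continuous_const.mul (continuous_const.mul (continuous_exp_mul_I ε))).div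
      ((continuous_const.mul (continuous_exp_mul_I ε)).sub continuous_const) hne
  split_ifs with hlt
  · have ha : a ≠ 0 := fun h0 => by
      rw [h0, norm_zero] at hlt; exact absurd (norm_nonneg q) (not_le.2 hlt)
    -- Inside the circle, `a E - q = a E (1 - (q/a) E⁻¹)` with `E = exp (iεt)`. The logarithm of the
    -- second factor is single-valued since `‖q/a‖ < 1`, and the linear term carries the winding.
    have hd : ∀ t : ℝ, HasDerivAt (fun t : ℝ => (t : ℂ) * (ε * Complex.I) +
        Complex.log (1 + -(q / a) * Complex.exp ((-ε * t : ℝ) * Complex.I)))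
        (a * (ε * Complex.I * Complex.exp ((ε * t : ℝ) * Complex.I)) / (loopCurve w a ε t - p)) t := by
      intro t
      have h1 : HasDerivAt (fun t : ℝ => (t : ℂ) * (ε * Complex.I)) (ε * Complex.I) t := by
        simpa using (Complex.ofRealCLM.hasDerivAt (x := t)).mul_const (ε * Complex.I)
      have h2 := (((hasDerivAt_exp_mul_I (-ε) t).const_mul (-(q / a))).const_add 1).clog_real
        (one_add_mem_slitPlane (by
          rw [norm_mul, norm_exp_mul_I, mul_one, norm_neg, norm_div]
          exact (div_lt_one (norm_pos_iff.2 ha)).2 hlt))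
      refine (h1.add h2).congr_deriv ?_
      have hn := hne t
      have hinv : Complex.exp ((-ε * t : ℝ) * Complex.I) =
          (Complex.exp ((ε * t : ℝ) * Complex.I))⁻¹ := by
        rw [← Complex.exp_neg]; congr 1; push_cast; ring
      rw [hcurve, hinv]
      have hE' := hE t
      generalize Complex.exp ((ε * t : ℝ) * Complex.I) = E at hn hE'
      have h3 : 1 + -(q / a) * E⁻¹ = (a * E - q) / (a * E) := by field_simp; ring
      rw [h3]
      push_cast
      field_simp
      ring
    rw [intervalIntegral.integral_eq_sub_of_hasDerivAt (fun t _ => hd t)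
      (hcont.intervalIntegrable _ _)]
    have hε' : -ε = 1 ∨ -ε = -1 := by rcases hε with rfl | rfl <;> simp
    rw [exp_sign_mul_pi hε' _ (Or.inl rfl), exp_sign_mul_pi hε' _ (Or.inr rfl)]
    push_cast
    ring
  · have hgt : ‖a‖ < ‖q‖ := lt_of_le_of_ne (not_lt.1 hlt) h.symm
    have hq0 : q ≠ 0 := fun h0 => by
      rw [h0, norm_zero] at hgt; exact absurd (norm_nonneg a) (not_le.2 hgt)
    -- Outside the circle, factor out `-q` instead: the primitive is periodic and the integral
    -- vanishes.
    have hd : ∀ t : ℝ, HasDerivAt (fun t : ℝ =>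
        Complex.log (1 + -(a / q) * Complex.exp ((ε * t : ℝ) * Complex.I)))
        (a * (ε * Complex.I * Complex.exp ((ε * t : ℝ) * Complex.I)) / (loopCurve w a ε t - p)) t := by
      intro t
      have h2 := (((hasDerivAt_exp_mul_I ε t).const_mul (-(a / q))).const_add 1).clog_real
        (one_add_mem_slitPlane (by
          rw [norm_mul, norm_exp_mul_I, mul_one, norm_neg, norm_div]
          exact (div_lt_one (norm_pos_iff.2 hq0)).2 hgt))
      refine h2.congr_deriv ?_
      have hn := hne t
      rw [hcurve]
      generalize Complex.exp ((ε * t : ℝ) * Complex.I) = E at hn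
      have h3 : 1 + -(a / q) * E = -((a * E - q) / q) := by field_simp; ring
      rw [h3]
      field_simp
    rw [intervalIntegral.integral_eq_sub_of_hasDerivAt (fun t _ => hd t)
      (hcont.intervalIntegrable _ _), exp_sign_mul_pi hε _ (Or.inl rfl),
      exp_sign_mul_pi hε _ (Or.inr rfl)]
    simp

/-- The integral splits at `±π`: the outer pieces reassemble to the integral over `γ` truncated at
`T - π`, and the middle piece is the winding number of the circle. -/
theorem hasPV_insertLoop (hγ : IsVerticalContour γ) (hε : ε = 1 ∨ ε = -1) {p v : ℂ}
    (hp : HasPV γ p v) (h : ‖p - γ 0 - a‖ ≠ ‖a‖) :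
    HasPV (insertLoop γ a ε) p (v + if ‖p - γ 0 - a‖ < ‖a‖ then (ε : ℂ) else 0) := by
  have hγ' := isVerticalContour_insertLoop hγ a hε
  have hne : ∀ t, insertLoop γ a ε t ≠ p := by
    intro t ht
    rcases le_total t (-Real.pi) with h1 | h1
    · rw [insertLoop_of_le hε h1] at ht; exact hp.1 _ ht
    rcases le_total t Real.pi with h2 | h2
    · rw [insertLoop_of_mem h1 h2] at ht
      apply h
      rw [← ht]
      have : γ 0 + a * (Complex.exp ((ε * t : ℝ) * Complex.I) + 1) - γ 0 - a =
        a * Complex.exp ((ε * t : ℝ) * Complex.I) := by ring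
      rw [this, norm_mul, norm_exp_mul_I, mul_one]
    · rw [insertLoop_of_ge hε h2] at ht; exact hp.1 _ ht
  refine ⟨hne, ?_⟩
  have hint : ∀ (δ : ℝ → ℂ), IsVerticalContour δ → (∀ t, δ t ≠ p) → ∀ x y,
      IntervalIntegrable (fun t => deriv δ t / (δ t - p)) volume x y := fun δ hδ hδp x y => by
    simp only [div_eq_inv_mul]
    exact hδ.intervalIntegrable_mul_deriv
      ((hδ.continuous.sub continuous_const).inv₀ fun t => sub_ne_zero.2 (hδp t)) x y
  have hsub : Tendsto (fun T : ℝ => T - Real.pi) atTop atTop :=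
    tendsto_atTop_add_const_right atTop (-Real.pi) tendsto_id
  have hlim := (hp.2.comp hsub).add_const (if ‖p - γ 0 - a‖ < ‖a‖ then (ε : ℂ) else 0)
  refine hlim.congr' ?_
  filter_upwards [eventually_gt_atTop Real.pi] with T hT
  have i1 : ∫ t in (-T)..(-Real.pi), deriv (insertLoop γ a ε) t / (insertLoop γ a ε t - p) =
      ∫ t in (-(T - Real.pi))..0, deriv γ t / (γ t - p) := by
    rw [intervalIntegral.integral_congr_Ioo_of_le (by linarith) (g := fun t =>
      deriv γ (t + Real.pi) / (γ (t + Real.pi) - p)),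
      intervalIntegral.integral_comp_add_right (fun t => deriv γ t / (γ t - p))]
    · congr 1 <;> ring
    · intro t ht
      simp only [deriv_insertLoop_lt hε ht.2, insertLoop_of_le hε ht.2.le]
  have i2 : ∫ t in Real.pi..T, deriv (insertLoop γ a ε) t / (insertLoop γ a ε t - p) =
      ∫ t in 0..(T - Real.pi), deriv γ t / (γ t - p) := by
    rw [intervalIntegral.integral_congr_Ioo_of_le hT.le (g := fun t =>
      deriv γ (t - Real.pi) / (γ (t - Real.pi) - p)),
      intervalIntegral.integral_comp_sub_right (fun t => deriv γ t / (γ t - p))]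
    · rw [sub_self]
    · intro t ht
      simp only [deriv_insertLoop_gt hε ht.1, insertLoop_of_ge hε ht.1.le]
  have i3 : ∫ t in (-Real.pi)..Real.pi, deriv (insertLoop γ a ε) t / (insertLoop γ a ε t - p) =
      2 * Real.pi * Complex.I * (if ‖p - γ 0 - a‖ < ‖a‖ then (ε : ℂ) else 0) := by
    rw [← integral_loopCurve hε h]
    refine intervalIntegral.integral_congr_Ioo_of_le (by linarith [Real.pi_pos]) fun t ht => ?_
    simp only [deriv_insertLoop_mem ht.1 ht.2, insertLoop_of_mem ht.1.le ht.2.le, loopCurve]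
  have hi := hint _ hγ' hne
  have hi0 := hint _ hγ hp.1
  rw [← intervalIntegral.integral_add_adjacent_intervals (hi (-T) (-Real.pi)) (hi _ _),
    ← intervalIntegral.integral_add_adjacent_intervals (hi (-Real.pi) Real.pi) (hi _ _), i1, i2, i3,
    Function.comp, ← intervalIntegral.integral_add_adjacent_intervals (hi0 _ 0) (hi0 _ _)]
  have := Complex.two_pi_I_ne_zero
  field_simp
  ring

end insertLoop

theorem isVerticalContour_comp_sub {γ : ℝ → ℂ} (hγ : IsVerticalContour γ) (s : ℝ) :
    IsVerticalContour fun t => γ (t - s) where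
  continuous := hγ.continuous.comp (continuous_id.sub continuous_const)
  piecewise_C1 := by
    obtain ⟨S, hS, hd⟩ := hγ.piecewise_C1
    refine ⟨(fun x => x + s) '' S, hS.image _, fun t ht => ?_⟩
    have hS' : t - s ∉ S := fun hs => ht ⟨_, hs, by simp⟩
    have hd' : deriv (fun x => γ (x - s)) = fun x => deriv γ (x - s) :=
      funext fun x => deriv_comp_sub_const _ _ _
    refine ⟨((hd _ hS').1.hasDerivAt.comp_sub_const t s).differentiableAt, ?_⟩
    rw [hd']
    exact ContinuousAt.comp (f := fun x => x - s) (hd _ hS').2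
      (continuous_id.sub continuous_const).continuousAt
  velocity_bounded := by
    obtain ⟨M, hM⟩ := hγ.velocity_bounded
    exact ⟨M, fun t => by rw [deriv_comp_sub_const]; exact hM _⟩
  vertical := by
    obtain ⟨M, hM⟩ := hγ.vertical
    refine ⟨M + |s|, fun t => ?_⟩
    have e : γ (t - s) - t * Complex.I =
        (γ (t - s) - (t - s : ℝ) * Complex.I) + -(s * Complex.I) := by push_cast; ring
    rw [e]
    refine (norm_add_le _ _).trans (add_le_add (hM _) ?_)
    simp

theorem tendsto_integral_tail {f : ℝ → ℂ} (hf : Tendsto f (cocompact ℝ) (𝓝 0)) (s : ℝ)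
    {x : ℝ → ℝ} (hx : Tendsto (fun T => |x T|) atTop atTop) :
    Tendsto (fun T => ∫ t in (x T)..(x T + s), f t) atTop (𝓝 0) := by
  rw [Metric.tendsto_atTop]
  intro δ hδ
  have hδ' : 0 < δ / (|s| + 1) := by positivity
  obtain ⟨r, hr⟩ : ∃ r : ℝ, ∀ t, r ≤ |t| → ‖f t‖ ≤ δ / (|s| + 1) := by
    have h1 := hf.norm
    rw [norm_zero] at h1
    have h2 := h1.eventually (ge_mem_nhds hδ')
    rw [← Metric.cobounded_eq_cocompact, ← comap_norm_atTop, eventually_comap] at h2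
    obtain ⟨r, hr⟩ := eventually_atTop.1 h2
    exact ⟨r, fun t ht => hr _ ht t rfl⟩
  obtain ⟨T0, hT0⟩ := eventually_atTop.1 (hx.eventually (eventually_ge_atTop (r + |s|)))
  refine ⟨T0, fun T hT => ?_⟩
  rw [dist_zero_right]
  have := intervalIntegral.norm_integral_le_of_norm_le_const (f := f) (a := x T) (b := x T + s)
    (C := δ / (|s| + 1)) fun t ht => hr t (by
      have h3 := hT0 T hT
      have h4 : |t - x T| ≤ |s| := by
        have := Set.abs_sub_left_of_mem_uIcc (Set.uIoc_subset_uIcc ht)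
        simpa using this
      have h5 := abs_sub_abs_le_abs_sub (x T) t
      rw [abs_sub_comm] at h5
      linarith)
  refine this.trans_lt ?_
  rw [add_sub_cancel_left, div_mul_eq_mul_div, div_lt_iff₀ (by positivity)]
  nlinarith [abs_nonneg s]

/-- A parameter shift changes the truncated integral by two pieces of fixed length at the ends,
where the integrand tends to `0`. -/
theorem hasPV_comp_sub {γ : ℝ → ℂ} (hγ : IsVerticalContour γ) (s : ℝ) {p v : ℂ}
    (hp : HasPV γ p v) : HasPV (fun t => γ (t - s)) p v := by
  refine ⟨fun t => hp.1 _, ?_⟩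
  have hint : ∀ x y, IntervalIntegrable (fun t => deriv γ t / (γ t - p)) volume x y := fun x y => by
    simp only [div_eq_inv_mul]
    exact hγ.intervalIntegrable_mul_deriv
      ((hγ.continuous.sub continuous_const).inv₀ fun t => sub_ne_zero.2 (hp.1 t)) x y
  have hf : Tendsto (fun t => deriv γ t / (γ t - p)) (cocompact ℝ) (𝓝 0) := by
    obtain ⟨M, hM⟩ := hγ.velocity_bounded
    obtain ⟨M', hM'⟩ := hγ.vertical
    have hM0 : 0 ≤ M := (norm_nonneg _).trans (hM 0)
    have h1 : Tendsto (fun t : ℝ => M * (‖t‖ + -(M' + ‖p‖))⁻¹) (cocompact ℝ) (𝓝 0) := by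
      rw [← mul_zero M]
      exact (tendsto_inv_atTop_zero.comp
        (tendsto_atTop_add_const_right _ _ (tendsto_norm_cocompact_atTop))).const_mul M
    refine squeeze_zero_norm' ?_ h1
    filter_upwards [(tendsto_norm_cocompact_atTop (E := ℝ)).eventually
      (eventually_gt_atTop (M' + ‖p‖))] with t ht
    rw [norm_div, div_eq_mul_inv]
    refine mul_le_mul (hM t) ?_ (by positivity) hM0
    refine inv_anti₀ (by linarith) ?_
    have h2 : ‖(t : ℂ) * Complex.I‖ = ‖t‖ := by simp
    have h3 : (t : ℂ) * Complex.I = (γ t - p) - (γ t - t * Complex.I) + p := by ring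
    have h4 := (norm_add_le ((γ t - p) - (γ t - t * Complex.I)) p)
    rw [← h3, h2] at h4
    have h5 := norm_sub_le (γ t - p) (γ t - t * Complex.I)
    have h6 := hM' t
    linarith
  have t1 := tendsto_integral_tail hf (-s) (x := fun T => T) tendsto_abs_atTop_atTop
  have t2 := tendsto_integral_tail hf (-s) (x := fun T => -T)
    (by simpa using tendsto_abs_atTop_atTop)
  have := hp.2.add ((t1.sub t2).const_mul (2 * Real.pi * Complex.I)⁻¹)
  rw [sub_zero, mul_zero, add_zero] at this
  refine this.congr fun T => ?_
  rw [← mul_add]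
  congr 1
  simp only [deriv_comp_sub_const]
  rw [intervalIntegral.integral_comp_sub_right (fun t => deriv γ t / (γ t - p)),
    ← intervalIntegral.integral_add_adjacent_intervals (hint (-T - s) (-T)) (hint (-T) (T - s)),
    ← intervalIntegral.integral_add_adjacent_intervals (hint (-T) T) (hint T (T - s)),
    intervalIntegral.integral_symm (-T) (-T - s)]
  simp only [← sub_eq_add_neg]
  ring

/-- Insertion of a circle through `γ 0`, not changing `γ 0`. -/
theorem exists_insert_circle {γ : ℝ → ℂ} (hγ : IsVerticalContour γ) (a : ℂ) {ε : ℝ}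
    (hε : ε = 1 ∨ ε = -1) :
    ∃ δ : ℝ → ℂ, IsVerticalContour δ ∧ δ 0 = γ 0 ∧ ∀ p v, HasPV γ p v → ‖p - γ 0 - a‖ ≠ ‖a‖ →
      HasPV δ p (v + if ‖p - γ 0 - a‖ < ‖a‖ then (ε : ℂ) else 0) := by
  have h := isVerticalContour_insertLoop hγ a hε
  -- The shift by `π` puts the start of the circle at parameter `0`, so that further circles can be
  -- inserted at the same base point.
  refine ⟨fun t => insertLoop γ a ε (t - Real.pi), isVerticalContour_comp_sub h _, ?_,
    fun p v hp hpa => hasPV_comp_sub h _ (hasPV_insertLoop hγ hε hp hpa)⟩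
  simp only [zero_sub]
  rw [insertLoop_of_le hε le_rfl, neg_add_cancel]

/-! ### Circles through a common point and correction of sides -/

theorem norm_sub_lt_norm_iff (x a : ℂ) :
    (‖x - a‖ < ‖a‖ ↔ ‖x‖ ^ 2 - 2 * (x * star a).re < 0) ∧
      (‖x - a‖ = ‖a‖ ↔ ‖x‖ ^ 2 - 2 * (x * star a).re = 0) := by
  have h : ‖x - a‖ ^ 2 = ‖a‖ ^ 2 + (‖x‖ ^ 2 - 2 * (x * star a).re) := by
    simp only [Complex.sq_norm, Complex.normSq_apply, Complex.sub_re, Complex.sub_im,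
      Complex.mul_re, Complex.star_def, Complex.conj_re, Complex.conj_im]
    ring
  constructor
  · rw [← pow_lt_pow_iff_left₀ (norm_nonneg _) (norm_nonneg _) two_ne_zero, h]
    constructor <;> intro h <;> linarith
  · rw [← pow_left_inj₀ (norm_nonneg _) (norm_nonneg _) two_ne_zero, h]
    constructor <;> intro h <;> linarith

/-- There is a circle through `0` that passes through `y` and no other point of a countable set. -/
theorem exists_circle_through {X : Set ℂ} (hX : X.Countable) (h0 : (0 : ℂ) ∉ X) (y : ℂ) :
    ∃ a : ℂ, ‖y‖ ^ 2 - 2 * (y * star a).re = 0 ∧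
      ∀ x ∈ X, x ≠ y → ‖x‖ ^ 2 - 2 * (x * star a).re ≠ 0 := by
  -- The centres `(y/2)(1 + is)` lie on the perpendicular bisector of `0` and `y`. A point `x` not
  -- on the line through `0` and `y` excludes one value of `s`; on that line only `0` and `y` lie on
  -- the circle.
  obtain ⟨s, hs⟩ : ∃ s : ℝ, s ∉ (fun x : ℂ => (‖x‖ ^ 2 - (x * star y).re) / (x * star y).im) '' X :=
    ((hX.image _).dense_compl ℝ).nonempty
  have key : ∀ x : ℂ, ‖x‖ ^ 2 - 2 * (x * star (y / 2 * (1 + s * Complex.I))).re =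
      ‖x‖ ^ 2 - (x * star y).re - s * (x * star y).im := fun x => by
    simp only [Complex.star_def, map_mul, map_div₀, map_add, map_one, Complex.conj_ofReal,
      Complex.conj_I, Complex.conj_ofNat]
    have : x * ((starRingEnd ℂ) y / 2 * (1 + s * -Complex.I)) =
      ((1 / 2 : ℝ) : ℂ) * ((x * (starRingEnd ℂ) y) + -(s : ℂ) * ((x * (starRingEnd ℂ) y) * Complex.I)) := by
      push_cast; ring
    rw [this, Complex.re_ofReal_mul, Complex.add_re, ← Complex.ofReal_neg, Complex.re_ofReal_mul,
      Complex.mul_I_re]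
    ring
  refine ⟨y / 2 * (1 + s * Complex.I), ?_, fun x hx hxy h => ?_⟩
  · rw [key]
    simp only [Complex.sq_norm, Complex.normSq_apply, Complex.mul_re, Complex.mul_im,
      Complex.star_def, Complex.conj_re, Complex.conj_im]
    ring
  · rw [key] at h
    by_cases him : (x * star y).im = 0
    · rw [him, mul_zero, sub_zero] at h
      have hx0 : x ≠ 0 := fun h' => h0 (h' ▸ hx)
      have h1 : x * star y = x * star x := by
        apply Complex.ext
        · rw [← sub_eq_zero.1 h]
          simp [Complex.sq_norm, Complex.normSq_apply]
        · rw [him]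
          simp
          ring
      exact hxy (star_injective (mul_left_cancel₀ hx0 h1)).symm
    · exact hs ⟨x, hx, by rw [div_eq_iff him]; linarith⟩

/-- Two circles through `0` enclosing the same points of a locally finite set, except for `y`,
which lies inside the first one only. -/
theorem exists_circle_pair {X : Set ℂ} (hX : X.Countable)
    (hfin : ∀ r : ℝ, {x ∈ X | ‖x‖ ≤ r}.Finite) (h0 : (0 : ℂ) ∉ X) {y : ℂ} (hy : y ≠ 0) :
    ∃ a b : ℂ, (‖y - a‖ < ‖a‖ ∧ ‖b‖ < ‖y - b‖) ∧ ∀ x ∈ X, x ≠ y →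
      ‖x - a‖ ≠ ‖a‖ ∧ ‖x - b‖ ≠ ‖b‖ ∧ (‖x - a‖ < ‖a‖ ↔ ‖x - b‖ < ‖b‖) := by
  obtain ⟨a, ha, hne⟩ := exists_circle_through hX h0 y
  have hpos : ∀ᶠ δ in 𝓝[>] (0 : ℝ), 0 < δ ∧ δ < 1 :=
    Ioo_mem_nhdsGT one_pos
  -- The circles with centres `(1 ± δ) a` through `0` have radius below `2 ‖a‖`, so points with `‖x‖
  -- > 4 ‖a‖` are outside both. The finitely many others keep their side for small `δ`.
  have hev : ∀ᶠ δ in 𝓝[>] (0 : ℝ), ∀ x ∈ {x ∈ X | ‖x‖ ≤ 4 * ‖a‖}, x ≠ y →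
      |δ * (2 * (x * star a).re)| < |‖x‖ ^ 2 - 2 * (x * star a).re| := by
    rw [(hfin _).eventually_all]
    intro x hx
    by_cases hxy : x = y
    · exact Eventually.of_forall fun _ h => absurd hxy h
    have hlim : Tendsto (fun δ : ℝ => |δ * (2 * (x * star a).re)|) (𝓝[>] 0) (𝓝 0) := by
      have : Continuous fun δ : ℝ => |δ * (2 * (x * star a).re)| := by fun_prop
      have h := this.tendsto 0
      rw [zero_mul, abs_zero] at h
      exact h.mono_left nhdsWithin_le_nhds
    filter_upwards [hlim.eventually (gt_mem_nhds (abs_pos.2 (hne x hx.1 hxy)))] with δ hδ _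
    exact hδ
  obtain ⟨δ, hδ, hδ0, hδ1⟩ := (hev.and hpos).exists
  have hscale : ∀ (c : ℝ) (x : ℂ), (x * star ((c : ℂ) * a)).re = c * (x * star a).re := fun c x => by
    rw [star_mul', Complex.star_def, Complex.conj_ofReal, mul_left_comm,
      Complex.re_ofReal_mul]
  have hy2 : 0 < ‖y‖ ^ 2 := by positivity
  -- Since `‖y‖² = 2 Re (y ā)`, the criterion `‖y‖² - 2 Re (y c̄)` for the centre `c = (1 ± δ) a`
  -- equals `∓δ ‖y‖²`: enlarging takes `y` in, shrinking leaves it out.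
  refine ⟨((1 + δ : ℝ) : ℂ) * a, ((1 - δ : ℝ) : ℂ) * a, ⟨?_, ?_⟩, fun x hx hxy => ?_⟩
  · rw [(norm_sub_lt_norm_iff _ _).1, hscale]
    nlinarith
  · rw [← not_le, le_iff_lt_or_eq, (norm_sub_lt_norm_iff _ _).1, (norm_sub_lt_norm_iff _ _).2, hscale]
    rintro (h | h) <;> nlinarith
  · simp only [Ne, (norm_sub_lt_norm_iff _ _).1, (norm_sub_lt_norm_iff _ _).2, hscale]
    set u := (x * star a).re with hu
    rcases le_or_gt ‖x‖ (4 * ‖a‖) with hx4 | hx4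
    · have h1 := hδ x ⟨hx, hx4⟩ hxy
      rcases lt_or_ge (‖x‖ ^ 2 - 2 * u) 0 with h2 | h2
      · rw [abs_of_neg h2, abs_lt] at h1
        refine ⟨fun h => by nlinarith, fun h => by nlinarith, fun h => by nlinarith, fun h => by nlinarith⟩
      · rw [abs_of_nonneg h2, abs_lt] at h1
        refine ⟨fun h => by nlinarith, fun h => by nlinarith, fun h => by nlinarith, fun h => by nlinarith⟩
    · have h1 : |u| ≤ ‖x‖ * ‖a‖ := by
        have := Complex.abs_re_le_norm (x * star a)
        rwa [norm_mul, norm_star] at this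
      have hx0 : 0 < ‖x‖ := lt_of_le_of_lt (by positivity) hx4
      have h2 : 4 * (‖x‖ * ‖a‖) < ‖x‖ ^ 2 := by nlinarith
      have h3 : ∀ c : ℝ, 0 < c → c < 2 → 0 < ‖x‖ ^ 2 - 2 * (c * u) := fun c hc hc' => by
        have h4 : c * u ≤ c * (‖x‖ * ‖a‖) :=
          mul_le_mul_of_nonneg_left ((le_abs_self u).trans h1) hc.le
        have h5 : c * (‖x‖ * ‖a‖) ≤ 2 * (‖x‖ * ‖a‖) :=
          mul_le_mul_of_nonneg_right hc'.le (by positivity)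
        linarith
      have h5 := h3 (1 + δ) (by linarith) (by linarith)
      have h6 := h3 (1 - δ) (by linarith) (by linarith)
      exact ⟨h5.ne', h6.ne', fun h => absurd h (by linarith), fun h => absurd h (by linarith)⟩

/-- Changing the principal value at a single point `p` of a locally finite set `Z` by `±1`. -/
theorem exists_toggle {Z : Set ℂ} (hZ : Z.Countable) {w : ℂ}
    (hfin : ∀ r : ℝ, {z ∈ Z | ‖z - w‖ ≤ r}.Finite) (hw : w ∉ Z) {γ : ℝ → ℂ}
    (hγ : IsVerticalContour γ) (h0 : γ 0 = w) {p : ℂ} (hp : p ∈ Z) {ε : ℝ} (hε : ε = 1 ∨ ε = -1)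
    {v : ℂ → ℂ} (hv : ∀ q ∈ Z, HasPV γ q (v q)) :
    ∃ δ : ℝ → ℂ, IsVerticalContour δ ∧ δ 0 = w ∧
      ∀ q ∈ Z, HasPV δ q (v q + if q = p then (ε : ℂ) else 0) := by
  obtain ⟨a, b, ⟨hpa, hpb⟩, hab⟩ := exists_circle_pair (X := (fun z => z - w) '' Z) (hZ.image _)
    (fun r => ((hfin r).image (fun z => z - w)).subset (by
      rintro _ ⟨⟨z, hz, rfl⟩, hr⟩
      exact ⟨z, ⟨hz, hr⟩, rfl⟩))
    (by rintro ⟨z, hz, hzw⟩; exact hw (sub_eq_zero.1 hzw ▸ hz)) (y := p - w)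
    (sub_ne_zero.2 fun h => hw (h ▸ hp))
  have hε' : -ε = 1 ∨ -ε = -1 := by rcases hε with rfl | rfl <;> simp
  -- The first circle contributes `ε` and the second `-ε`; the contributions cancel at every point
  -- of `Z` other than `p`.
  obtain ⟨γ₁, h1, h10, h1v⟩ := exists_insert_circle hγ a hε
  obtain ⟨γ₂, h2, h20, h2v⟩ := exists_insert_circle h1 b hε'
  rw [h10, h0] at h2v h20
  rw [h0] at h1v
  refine ⟨γ₂, h2, h20, fun q hq => ?_⟩
  by_cases hqp : q = p
  · subst hqp
    have := h2v q _ (h1v q _ (hv q hq) hpa.ne) hpb.ne'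
    rw [if_pos hpa, if_neg (not_lt.2 hpb.le), add_zero] at this
    rwa [if_pos rfl]
  · obtain ⟨ha, hb, hiff⟩ := hab (q - w) ⟨q, hq, rfl⟩ fun h => hqp (by simpa using h)
    have := h2v q _ (h1v q _ (hv q hq) ha) hb
    rw [if_neg hqp]
    convert this using 1
    rw [add_assoc]
    congr 1
    simp only [hiff]
    split_ifs <;> simp

theorem exists_toggle_finset {Z : Set ℂ} (hZ : Z.Countable) {w : ℂ}
    (hfin : ∀ r : ℝ, {z ∈ Z | ‖z - w‖ ≤ r}.Finite) (hw : w ∉ Z) {γ : ℝ → ℂ}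
    (hγ : IsVerticalContour γ) (h0 : γ 0 = w) {e : ℂ → ℝ} (he : ∀ q, e q = 1 ∨ e q = -1)
    {v : ℂ → ℂ} (hv : ∀ q ∈ Z, HasPV γ q (v q)) (F : Finset ℂ) :
    (∀ q ∈ F, q ∈ Z) → ∃ δ : ℝ → ℂ, IsVerticalContour δ ∧ δ 0 = w ∧
      ∀ q ∈ Z, HasPV δ q (v q + if q ∈ F then (e q : ℂ) else 0) := by
  induction F using Finset.induction_on with
  | empty => exact fun _ => ⟨γ, hγ, h0, fun q hq => by simpa using hv q hq⟩
  | insert p F hpF ih =>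
    intro hF
    obtain ⟨δ, hδ, hδ0, hδv⟩ := ih fun q hq => hF q (Finset.mem_insert_of_mem hq)
    obtain ⟨δ', hδ', hδ0', hδv'⟩ := exists_toggle hZ hfin hw hδ hδ0
      (hF p (Finset.mem_insert_self p F)) (he p) hδv
    refine ⟨δ', hδ', hδ0', fun q hq => ?_⟩
    have := hδv' q hq
    by_cases hqp : q = p
    · subst hqp
      simpa [hpF] using this
    · simpa [hqp] using this

/-- A vertical contour with prescribed locally finite sets on its left and on its right. -/
theorem exists_contour_of_sets {A B : Set ℂ} (hA : A.Countable) (hB : B.Countable)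
    (hAB : Disjoint A B) (hfin : ∀ (w : ℂ) (r : ℝ), {z ∈ A ∪ B | ‖z - w‖ ≤ r}.Finite)
    (hA' : ∀ c : ℝ, {z ∈ A | c < z.re}.Finite) (hB' : ∀ c : ℝ, {z ∈ B | z.re < c}.Finite) :
    ∃ γ : ℝ → ℂ, IsVerticalContour γ ∧ (∀ p ∈ A, IsLeftOf γ p) ∧ ∀ p ∈ B, IsRightOf γ p := by
  classical
  have hZ : (A ∪ B).Countable := hA.union hB
  obtain ⟨c, hc⟩ : ∃ c : ℝ, c ∉ Complex.re '' (A ∪ B) := ((hZ.image _).dense_compl ℝ).nonempty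
  have hcne : ∀ z ∈ A ∪ B, z.re ≠ c := fun z hz h => hc ⟨z, hz, h⟩
  have hw : (c : ℂ) ∉ A ∪ B := fun h => hcne _ h (by simp)
  -- Start from a vertical line missing all the points. The finite set to toggle consists of the
  -- points of `A` right of it and those of `B` left of it, raised or lowered by `1` respectively.
  obtain ⟨γ, hγ, -, hv⟩ := exists_toggle_finset hZ (hfin c) hw (isVerticalContour_vLine c)
    (by simp [vLine]) (e := fun q => if q ∈ A then 1 else -1)
    (fun q => by split_ifs <;> simp) (v := fun q => if q.re < c then 1 / 2 else -1 / 2)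
    (fun q hq => by
      split_ifs with h
      · exact hasPV_vLine_left h
      · exact hasPV_vLine_right (lt_of_le_of_ne (not_lt.1 h) (hcne q hq).symm))
    ((hA' c).union (hB' c)).toFinset (fun q hq => by
      rcases (Set.Finite.mem_toFinset _).1 hq with h | h
      · exact Or.inl h.1
      · exact Or.inr h.1)
  refine ⟨γ, hγ, fun p hp => ?_, fun p hp => ?_⟩
  · have hpB : p ∉ B := fun h => Set.disjoint_left.1 hAB hp h
    have h := hv p (Or.inl hp)
    have hval : ((if p.re < c then 1 / 2 else -1 / 2 : ℂ) +
        if p ∈ ((hA' c).union (hB' c)).toFinset then (((if p ∈ A then 1 else -1 : ℝ)) : ℂ) else 0) =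
        1 / 2 := by
      rcases lt_or_gt_of_ne (hcne p (Or.inl hp)) with h1 | h1
      · simp [h1, hpB, hp, h1.le]
      · simp [h1, hpB, hp, not_lt.2 h1.le]
        norm_num
    simp only [hval] at h
    exact h
  · have hpA : p ∉ A := fun h => Set.disjoint_left.1 hAB h hp
    have h := hv p (Or.inr hp)
    have hval : ((if p.re < c then 1 / 2 else -1 / 2 : ℂ) +
        if p ∈ ((hA' c).union (hB' c)).toFinset then (((if p ∈ A then 1 else -1 : ℝ)) : ℂ) else 0) =
        -1 / 2 := by
      rcases lt_or_gt_of_ne (hcne p (Or.inr hp)) with h1 | h1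
      · simp [h1, hpA, hp]
        norm_num
      · simp [h1, hpA, hp, not_lt.2 h1.le]
    simp only [hval] at h
    exact h

theorem finite_range_add_natCast {x : ℂ} {P : ℂ → Prop} (M : ℝ)
    (hP : ∀ k : ℕ, P (x + k) → (k : ℝ) ≤ M) : {z ∈ Set.range fun k : ℕ => x + (k : ℂ) | P z}.Finite := by
  obtain ⟨m, hm⟩ := exists_nat_ge M
  refine ((Set.finite_Iic m).image fun k : ℕ => x + (k : ℂ)).subset ?_
  rintro _ ⟨⟨k, rfl⟩, hk⟩
  exact ⟨k, by exact_mod_cast (hP k hk).trans hm, rfl⟩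

theorem finite_range_sub_natCast {x : ℂ} {P : ℂ → Prop} (M : ℝ)
    (hP : ∀ k : ℕ, P (x - k) → (k : ℝ) ≤ M) : {z ∈ Set.range fun k : ℕ => x - (k : ℂ) | P z}.Finite := by
  obtain ⟨m, hm⟩ := exists_nat_ge M
  refine ((Set.finite_Iic m).image fun k : ℕ => x - (k : ℂ)).subset ?_
  rintro _ ⟨⟨k, rfl⟩, hk⟩
  exact ⟨k, by exact_mod_cast (hP k hk).trans hm, rfl⟩

/-- The parameter conditions keep the left poles distinct from the right ones: a coincidence would
force `-α` or `-β` into `{N+2, N+3, …}`, or `-α-β` into `{2N+3, 2N+4, …}`. -/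
theorem exists_isSeparatingContour {N : ℕ} {α β : ℂ}
    (hα : ∀ j : ℕ, 1 ≤ j → j ≠ N + 1 → -α ≠ (j : ℂ))
    (hβ : ∀ j : ℕ, 1 ≤ j → j ≠ N + 1 → -β ≠ (j : ℂ))
    (hαβ : ∀ j : ℕ, 1 ≤ j → j ≠ 2 * N + 2 → -α - β ≠ (j : ℂ)) :
    ∃ γ : ℝ → ℂ, IsSeparatingContour α β N γ := by
  have hadd : ∀ (x w : ℂ) (r : ℝ),
      {z ∈ Set.range fun k : ℕ => x + (k : ℂ) | ‖z - w‖ ≤ r}.Finite := fun x w r =>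
    finite_range_add_natCast (r + ‖x - w‖) fun k hk => by
      have h := norm_sub_le (x + k - w) (x - w)
      rw [show x + k - w - (x - w) = k by ring, Complex.norm_natCast] at h
      linarith
  have hsub : ∀ (x w : ℂ) (r : ℝ),
      {z ∈ Set.range fun k : ℕ => x - (k : ℂ) | ‖z - w‖ ≤ r}.Finite := fun x w r =>
    finite_range_sub_natCast (r + ‖x - w‖) fun k hk => by
      have h := norm_sub_le (x - w) (x - k - w)
      rw [show x - w - (x - k - w) = k by ring, Complex.norm_natCast] at h
      linarith
  have hadd' : ∀ (x : ℂ) (c : ℝ), {z ∈ Set.range fun k : ℕ => x + (k : ℂ) | z.re < c}.Finite :=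
    fun x c => finite_range_add_natCast (c - x.re) fun k hk => by
      rw [Complex.add_re, Complex.natCast_re] at hk
      linarith
  have hsub' : ∀ (x : ℂ) (c : ℝ), {z ∈ Set.range fun k : ℕ => x - (k : ℂ) | c < z.re}.Finite :=
    fun x c => finite_range_sub_natCast (x.re - c) fun k hk => by
      rw [Complex.sub_re, Complex.natCast_re] at hk
      linarith
  have hunion : ∀ (S T : Set ℂ) (P : ℂ → Prop), {z ∈ S | P z}.Finite → {z ∈ T | P z}.Finite →
      {z ∈ S ∪ T | P z}.Finite := fun S T P h1 h2 => (h1.union h2).subset (by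
    rintro z ⟨h | h, hz⟩
    · exact Or.inl ⟨h, hz⟩
    · exact Or.inr ⟨h, hz⟩)
  have hdisj : Disjoint
      ((Set.range fun k : ℕ => (-1 : ℂ) - k) ∪ Set.range fun k : ℕ => (-α - N - 2) - (k : ℂ))
      ((Set.range fun k : ℕ => (0 : ℂ) + k) ∪ Set.range fun k : ℕ => (β + N + 1) + (k : ℂ)) := by
    rw [Set.disjoint_left]
    rintro z (⟨k, rfl⟩ | ⟨k, rfl⟩) (⟨l, h⟩ | ⟨l, h⟩) <;> simp only at h
    · have h1 : ((l + k + 1 : ℕ) : ℂ) = 0 := by push_cast; linear_combination h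
      exact absurd h1 (by exact_mod_cast (l + k).succ_ne_zero)
    · exact hβ (N + 2 + l + k) (by omega) (by omega) (by push_cast; linear_combination -h)
    · exact hα (N + 2 + l + k) (by omega) (by omega) (by push_cast; linear_combination -h)
    · exact hαβ (2 * N + 3 + l + k) (by omega) (by omega) (by push_cast; linear_combination -h)
  obtain ⟨γ, hγ, hl, hr⟩ := exists_contour_of_sets
    ((Set.countable_range _).union (Set.countable_range _))
    ((Set.countable_range _).union (Set.countable_range _)) hdisj
    (fun w r => hunion _ _ _ (hunion _ _ _ (hsub _ w r) (hsub _ w r))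
      (hunion _ _ _ (hadd _ w r) (hadd _ w r)))
    (fun c => hunion _ _ _ (hsub' _ c) (hsub' _ c)) (fun c => hunion _ _ _ (hadd' _ c) (hadd' _ c))
  exact ⟨γ, hγ, fun k => hr _ (Or.inl ⟨k, zero_add _⟩), fun k => hr _ (Or.inr ⟨k, rfl⟩),
    fun k => hl _ (Or.inl ⟨k, rfl⟩), fun k => hl _ (Or.inr ⟨k, rfl⟩)⟩

end

theorem mainTheorem1 (N : ℕ) (α β : ℂ)
    (hα : ∀ j : ℕ, 1 ≤ j → j ≠ N + 1 → -α ≠ (j : ℂ))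
    (hβ : ∀ j : ℕ, 1 ≤ j → j ≠ N + 1 → -β ≠ (j : ℂ))
    (hαβ : ∀ j : ℕ, 1 ≤ j → j ≠ 2 * N + 2 → -α - β ≠ (j : ℂ)) :
    (∃ γ : ℝ → ℂ, IsSeparatingContour α β N γ) ∧
    ∀ γ : ℝ → ℂ, IsSeparatingContour α β N γ →
      (∀ f g : Polynomial ℂ, MeasureTheory.Integrable (sobolevIntegrand α β N γ f g)) ∧
      IsMOPS (sobolevForm α β N γ) (hahnPoly α β N) ∧
      (∀ (n : ℕ) (q : Polynomial ℂ),
        q = hahnPoly α β N n ↔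
          q.Monic ∧ q.natDegree = n ∧
            ∀ m < n, sobolevForm α β N γ q (Polynomial.X ^ m) = 0) ∧
      (∀ q : ℕ → Polynomial ℂ,
        IsMOPS (sobolevForm α β N γ) q ↔ q = hahnPoly α β N) := by
  refine ⟨exists_isSeparatingContour hα hβ hαβ, fun γ hγ => ⟨fun f g => ?_, ?_⟩⟩
  · rw [sobolevIntegrand_eq]
    exact hγ.integrable _
  · rw [sobolevForm_eq hγ]
    have h := sobolevBilin_hahnPoly hγ hα hβ hαβ
    have hm : ∀ n, (hahnPoly α β N n).Monic ∧ (hahnPoly α β N n).natDegree = n := fun n => by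
      rw [hahnPoly_eq_hahnGen]
      exact hahnGen_monic _ _ _ _
    exact mops_characterization (sobolevBilin hγ) (sobolevBilin_symm hγ) (fun n => (hm n).1)
      (fun n => (hm n).2) (fun n => (h n).1) (fun n => (h n).2)
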